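/- Let $(\bar M,\varphi,g)$ be a Kähler manifold: $g$ is a smooth Riemannian metric on the smooth manifold $\bar M$ and $\varphi$ is a smooth $(1,1)$-tensor field with $\varphi^2=-I$, $g(\varphi\cdot,\varphi\cdot)=g$ and $\bar\nabla\varphi=0$, where $\bar\nabla$ is the Levi-Civita connection of $g$. Let $M$ be a submanifold of $\bar M$ defined by a smooth injective immersion, with the induced metric, again denoted $g$, and its Levi-Civita connection $\nabla$. Let $T\bar M|_M=TM\oplus T^{\bot}M$ be the orthogonal decomposition into tangent and normal bundle. For $X,Y\in\Gamma(TM)$ and $V\in\Gamma(T^{\bot}M)$, let $h(X,Y)$ be the normal component of $\bar\nabla_XY$ (the second fundamental form), and let $-A_VX$ and $\nabla^{\bot}_XV$ be the tangential and the normal component of $\bar\nabla_XV$ (shape operator and normal connection). Write $\varphi X=TX+NX$ and $\varphi V=tV+nV$, where $TX,tV$ are tangent and $NX,nV$ are normal to $M$, and put $$(\nabla_XT)Y:=\nabla_X(TY)-T(\nabla_XY),\qquad (\nabla_XN)Y:=\nabla^{\bot}_X(NY)-N(\nabla_XY),$$ $$(\nabla_Xt)V:=\nabla_X(tV)-t(\nabla^{\bot}_XV),\qquad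 (\nabla_Xn)V:=\nabla^{\bot}_X(nV)-n(\nabla^{\bot}_XV).$$ Then, for all $X,Y\in\Gamma(TM)$ and $V\in\Gamma(T^{\bot}M)$: (i) $(\nabla_XT)Y=A_{NY}X+t\,h(X,Y)$; (ii) $(\nabla_XN)Y=-h(X,TY)+n\,h(X,Y)$; (iii) $(\nabla_Xt)V=A_{nV}X-T(A_VX)$; (iv) $(\nabla_Xn)V=-h(X,tV)-N(A_VX)$. Moreover, if $M$ is totally geodesic (that is, $h=0$), then $\nabla T=0$, $\nabla N=0$, $\nabla t=0$ and $\nabla n=0$, that is, the four expressions above vanish for all $X,Y\in\Gamma(TM)$ and $V\in\Gamma(T^{\bot}M)$. -/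

import Mathlib

open Bundle
open scoped Manifold ContDiff

noncomputable section

namespace KaehlerSubmanifold

section Riemannian

variable {E : Type*} [NormedAddCommGroup E] [NormedSpace ℝ E]
  {H : Type*} [TopologicalSpace H] {I : ModelWithCorners ℝ E H}
  {M : Type*} [TopologicalSpace M] [ChartedSpace H M]

/-- A (not necessarily continuous) vector field on `M`. -/
abbrev Field (I : ModelWithCorners ℝ E H) (M : Type*) [TopologicalSpace M] [ChartedSpace H M] :=
  Π p : M, TangentSpace I p

/-- A field of bilinear forms on the tangent spaces. -/
abbrev FormField (I : ModelWithCorners ℝ E H) (M : Type*) [TopologicalSpace M]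
    [ChartedSpace H M] :=
  Π p : M, TangentSpace I p →L[ℝ] TangentSpace I p →L[ℝ] ℝ

/-- A field of endomorphisms of the tangent spaces. -/
abbrev EndoField (I : ModelWithCorners ℝ E H) (M : Type*) [TopologicalSpace M]
    [ChartedSpace H M] :=
  Π p : M, TangentSpace I p →L[ℝ] TangentSpace I p

variable [IsManifold I ∞ M]

/-- `X ∈ Γ(TM)`: `X` is a smooth vector field. -/
def IsSmoothField (X : Field I M) : Prop :=
  ContMDiff I I.tangent ∞ (fun p => (⟨p, X p⟩ : TangentBundle I M))

/-- The connection `nabla` on `TM` is the Levi-Civita connection of the metric `g`: it is torsion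
free, `∇_X Y - ∇_Y X = [X, Y]`, and metric, `X g(Y, Z) = g(∇_X Y, Z) + g(Y, ∇_X Z)`.
Mathlib writes `nabla Y p v` for `(∇_v Y)(p)`. -/
structure IsLeviCivita [FiniteDimensional ℝ E] [CompleteSpace E] (g : FormField I M)
    (nabla : CovariantDerivative I E (TangentSpace I : M → Type _)) : Prop where
  torsion_free : nabla.torsion = 0
  metric : ∀ (Y Z : Field I M) (p : M),
    MDifferentiableAt I I.tangent (fun q => (⟨q, Y q⟩ : TangentBundle I M)) p →
    MDifferentiableAt I I.tangent (fun q => (⟨q, Z q⟩ : TangentBundle I M)) p →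
    ∀ v : TangentSpace I p,
      mvfderiv I (fun q => g q (Y q) (Z q)) p v =
        g p (nabla Y p v) (Z p) + g p (Y p) (nabla Z p v)

/-- The smooth Riemannian metric `g` and the smooth `(1,1)`-tensor field `φ` form an almost
Hermitian structure: `φ² = -I` and `g(φ ·, φ ·) = g`. -/
structure IsAlmostHermitian
    (g : ContMDiffRiemannianMetric I ∞ E (fun p : M => TangentSpace I p))
    (φ : EndoField I M) : Prop where
  smooth : ContMDiff I (I.prod 𝓘(ℝ, E →L[ℝ] E)) ∞
    (fun p => TotalSpace.mk' (E →L[ℝ] E)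
      (E := fun p : M => TangentSpace I p →L[ℝ] TangentSpace I p) p (φ p))
  sq : ∀ (p : M) (v : TangentSpace I p), φ p (φ p v) = -v
  isometric : ∀ (p : M) (v w : TangentSpace I p), g.inner p (φ p v) (φ p w) = g.inner p v w

/-- `(M, φ, g)` is a Kähler manifold, and `nabla` is its Levi-Civita connection: the structure is
almost Hermitian and `∇φ = 0`, that is, `∇_X (φ Y) = φ (∇_X Y)` for all `X, Y ∈ Γ(TM)`. -/
structure IsKaehler [FiniteDimensional ℝ E] [CompleteSpace E]
    (g : ContMDiffRiemannianMetric I ∞ E (fun p : M => TangentSpace I p))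
    (φ : EndoField I M)
    (nabla : CovariantDerivative I E (TangentSpace I : M → Type _)) : Prop where
  almostHermitian : IsAlmostHermitian g φ
  leviCivita : IsLeviCivita g.inner nabla
  parallel : ∀ X Y : Field I M, IsSmoothField X → IsSmoothField Y →
    ∀ p : M, nabla (fun q => φ q (Y q)) p (X p) = φ p (nabla Y p (X p))

end Riemannian

section Submanifold

variable {E : Type*} [NormedAddCommGroup E] [NormedSpace ℝ E]
  {H : Type*} [TopologicalSpace H] (I : ModelWithCorners ℝ E H)
  {M : Type*} [TopologicalSpace M] [ChartedSpace H M]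
  {F : Type*} [NormedAddCommGroup F] [NormedSpace ℝ F]
  {K : Type*} [TopologicalSpace K] {J : ModelWithCorners ℝ F K}
  {N : Type*} [TopologicalSpace N] [ChartedSpace K N] [IsManifold J ∞ N]

/-- A (not necessarily continuous) vector field along `f : M → N`, i.e. a section of `f^* TN`. -/
abbrev FieldAlong (J : ModelWithCorners ℝ F K) {N : Type*} [TopologicalSpace N]
    [ChartedSpace K N] (f : M → N) :=
  Π p : M, TangentSpace J (f p)

/-- The field `W` along `f` is smooth. -/
def IsSmoothAlong (f : M → N) (W : FieldAlong J f) : Prop :=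
  ContMDiff I J.tangent ∞ (fun p => (⟨f p, W p⟩ : TangentBundle J N))

/-- The derivative `∇̄_v W` of a field `W` along `f` in the direction `v ∈ T_p M`: the pull-back
along `f` of the connection `nablaBar` of `N`. Over a neighbourhood of `f p` let `e_w`, `w ∈ F`, be
the local vector fields of `N` that are constant in the standard trivialization of `TN` at `f p`
(equal to `w` there; these are the coordinate fields of the chart at `f p` and their constant linear
combinations), and write `W q = e_{w q} (f q)` with `w : M → F`. Then
`∇̄_v W = e_{dw_p(v)} (f p) + (∇̄_{df(v)} e_{w p})(f p)`. Near `f p` the field `e_{w p}` is Mathlib's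
`FiberBundle.extend F (W p)`. -/
def covAlong (nablaBar : CovariantDerivative J F (TangentSpace J : N → Type _)) (f : M → N)
    (W : FieldAlong J f) (p : M) : TangentSpace I p →L[ℝ] TangentSpace J (f p) :=
  let e := trivializationAt F (TangentSpace J) (f p)
  let w : M → F := fun q => (e (⟨f q, W q⟩ : TangentBundle J N)).2
  (e.symmL ℝ (f p)).comp (mvfderiv I w p) +
    (nablaBar (FiberBundle.extend F (W p)) (f p)).comp (mfderiv I J f p)

variable (g : ContMDiffRiemannianMetric J ∞ F (fun y : N => TangentSpace J y))
  (φ : EndoField J N) (f : M → N)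

/-- The metric induced on `M`: `(u, v) ↦ g(df u, df v)`. -/
def inducedMetric : FormField I M := fun p =>
  (ContinuousLinearMap.precomp ℝ (mfderiv I J f p)).comp ((g.inner (f p)).comp (mfderiv I J f p))

/-- The tangential component of `w ∈ T_{f p} N`, as a vector of `T_p M`: the vector `u` with
`g(df u, df v) = g(w, df v)` for all `v ∈ T_p M`. The induced metric, seen as a map
`T_p M → (T_p M)^*`, is invertible when `M` is finite dimensional and `f` is an immersion. -/
def tangential (p : M) : TangentSpace J (f p) →L[ℝ] TangentSpace I p :=
  (inducedMetric I g f p).inverse.comp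
    ((ContinuousLinearMap.precomp ℝ (mfderiv I J f p)).comp (g.inner (f p)))

/-- The normal component of `w ∈ T_{f p} N`. -/
def normal (p : M) :
    TangentSpace J (f p) →L[ℝ] TangentSpace J (f p) :=
  ContinuousLinearMap.id ℝ _ - (mfderiv I J f p).comp (tangential I g f p)

/-- `V ∈ Γ(T^⊥ M)`: `V` is a smooth field along `f` that is orthogonal to `df(TM)`. -/
def IsNormalField (V : FieldAlong J f) : Prop :=
  IsSmoothAlong I f V ∧
    ∀ (p : M) (v : TangentSpace I p), g.inner (f p) (V p) (mfderiv I J f p v) = 0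

/-- `T X`, the tangential component of `φ X`, for `X ∈ T_p M`. -/
def opT (p : M) : TangentSpace I p →L[ℝ] TangentSpace I p :=
  (tangential I g f p).comp ((φ (f p)).comp (mfderiv I J f p))

/-- `N X`, the normal component of `φ X`, for `X ∈ T_p M`. -/
def opN (p : M) : TangentSpace I p →L[ℝ] TangentSpace J (f p) :=
  (normal I g f p).comp ((φ (f p)).comp (mfderiv I J f p))

/-- `t V`, the tangential component of `φ V`, for `V` normal at `p`. -/
def opt (p : M) : TangentSpace J (f p) →L[ℝ] TangentSpace I p :=
  (tangential I g f p).comp (φ (f p))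

/-- `n V`, the normal component of `φ V`, for `V` normal at `p`. -/
def opn (p : M) :
    TangentSpace J (f p) →L[ℝ] TangentSpace J (f p) :=
  (normal I g f p).comp (φ (f p))

variable (nablaBar : CovariantDerivative J F (TangentSpace J : N → Type _))

/-- The second fundamental form: `h(X, Y)` is the normal component of `∇̄_X Y`. -/
def secondForm (X Y : Field I M) : FieldAlong J f := fun p =>
  normal I g f p (covAlong I nablaBar f (fun q => mfderiv I J f q (Y q)) p (X p))

/-- The shape operator: `A_V X` is minus the tangential component of `∇̄_X V`. -/
def shape (V : FieldAlong J f) (X : Field I M) : Field I M := fun p =>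
  -tangential I g f p (covAlong I nablaBar f V p (X p))

/-- The normal connection: `∇^⊥_X V` is the normal component of `∇̄_X V`. -/
def normalCov (X : Field I M) (V : FieldAlong J f) : FieldAlong J f := fun p =>
  normal I g f p (covAlong I nablaBar f V p (X p))

/-- `M` is totally geodesic: `h = 0`. -/
def IsTotallyGeodesic [IsManifold I ∞ M] : Prop :=
  ∀ X Y : Field I M, IsSmoothField X → IsSmoothField Y → secondForm I g f nablaBar X Y = 0

variable [IsManifold I ∞ M] (nabla : CovariantDerivative I E (TangentSpace I : M → Type _))

/-- `(∇_X T) Y = ∇_X (T Y) - T (∇_X Y)`. -/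
def covT (X Y : Field I M) : Field I M := fun p =>
  nabla (fun q => opT I g φ f q (Y q)) p (X p) - opT I g φ f p (nabla Y p (X p))

/-- `(∇_X N) Y = ∇^⊥_X (N Y) - N (∇_X Y)`. -/
def covN (X Y : Field I M) : FieldAlong J f := fun p =>
  normalCov I g f nablaBar X (fun q => opN I g φ f q (Y q)) p - opN I g φ f p (nabla Y p (X p))

/-- `(∇_X t) V = ∇_X (t V) - t (∇^⊥_X V)`. -/
def covt (X : Field I M) (V : FieldAlong J f) : Field I M := fun p =>
  nabla (fun q => opt I g φ f q (V q)) p (X p) - opt I g φ f p (normalCov I g f nablaBar X V p)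

/-- `(∇_X n) V = ∇^⊥_X (n V) - n (∇^⊥_X V)`. -/
def covn (X : Field I M) (V : FieldAlong J f) : FieldAlong J f := fun p =>
  normalCov I g f nablaBar X (fun q => opn I g φ f q (V q)) p -
    opn I g φ f p (normalCov I g f nablaBar X V p)

end Submanifold

end KaehlerSubmanifold

end

open scoped Topology

noncomputable section

/-! The pulled back connection `covAlong` inherits three properties from the ambient one: it is
metric (`IsLeviCivita.covAlong_metric`), torsion free on fields `df Y` (`covAlong_mfderiv_sub`), and
it commutes with `φ` (`IsKaehler.covAlong_endo`). The first and last are proved by tensoriality: the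
defect of the identity is linear over functions differentiable at `p`, so it depends only on the
values at `p`, and the fields may be replaced by pull-backs of ambient fields, for which the
identity is the ambient one. Torsion is a computation in a chart.

Metric and torsion free together give the Gauss formula (`tangential_covAlong_mfderiv`): the
tangential part of `∇̄_X Y` is the intrinsic `∇_X Y`, by the uniqueness argument for Levi-Civita
connections. All four formulas are then `∇̄_X(φW) = φ(∇̄_X W)`, split into tangential and normal
parts: `W = df Y` gives those for `T` and `N`, and `W = V` gives those for `t` and `n`.

If `h = 0`, differentiating `g(V, df Y) = 0` gives `A = 0` as well, so every term on the right
vanishes. This needs `TY`, `NY`, `tV`, `nV` to be smooth, which rests on smoothness of the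
tangential projection (`IsSmoothAlong.tangential`). -/

namespace KaehlerSubmanifold

/-! ### Calculus of the pulled back connection. -/

section Along

variable {E : Type*} [NormedAddCommGroup E] [NormedSpace ℝ E]
  {H : Type*} [TopologicalSpace H] {I : ModelWithCorners ℝ E H}
  {M : Type*} [TopologicalSpace M] [ChartedSpace H M]
  {F : Type*} [NormedAddCommGroup F] [NormedSpace ℝ F]
  {K : Type*} [TopologicalSpace K] {J : ModelWithCorners ℝ F K}
  {N : Type*} [TopologicalSpace N] [ChartedSpace K N] [IsManifold J ∞ N]
  {f : M → N} {p : M}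

variable (I) in
/-- The field `W` along `f` is differentiable at `p`. -/
def IsDiffAlongAt (f : M → N) (W : FieldAlong J f) (p : M) : Prop :=
  MDifferentiableAt I J.tangent (fun q => (⟨f q, W q⟩ : TangentBundle J N)) p

/-- The coordinates of a field along `f` in the standard trivialization at `f p`. -/
def coordAlong (f : M → N) (p : M) (W : FieldAlong J f) : M → F := fun q =>
  (trivializationAt F (TangentSpace J) (f p) (⟨f q, W q⟩ : TangentBundle J N)).2

omit [IsManifold J ∞ N] in
theorem eventually_mem_baseSet [IsManifold J 1 N] (hf : ContinuousAt f p) :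
    ∀ᶠ q in 𝓝 p, f q ∈ (trivializationAt F (TangentSpace J) (f p)).baseSet :=
  hf ((trivializationAt F (TangentSpace J) (f p)).open_baseSet.mem_nhds
    (FiberBundle.mem_baseSet_trivializationAt' (f p)))

theorem isDiffAlongAt_iff {W : FieldAlong J f} (hf : MDifferentiableAt I J f p) :
    IsDiffAlongAt I f W p ↔ MDifferentiableAt I 𝓘(ℝ, F) (coordAlong f p W) p := by
  unfold IsDiffAlongAt
  rw [mdifferentiableAt_totalSpace]
  exact and_iff_right hf

theorem IsDiffAlongAt.base {W : FieldAlong J f} (hW : IsDiffAlongAt I f W p) :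
    MDifferentiableAt I J f p := by
  unfold IsDiffAlongAt at hW
  rw [mdifferentiableAt_totalSpace] at hW
  exact hW.1

theorem IsDiffAlongAt.coord {W : FieldAlong J f} (hW : IsDiffAlongAt I f W p) :
    MDifferentiableAt I 𝓘(ℝ, F) (coordAlong f p W) p :=
  (isDiffAlongAt_iff hW.base).1 hW

theorem coordAlong_add_eventuallyEq (hf : ContinuousAt f p) (W W' : FieldAlong J f) :
    coordAlong f p (W + W') =ᶠ[𝓝 p] coordAlong f p W + coordAlong f p W' := by
  filter_upwards [eventually_mem_baseSet (J := J) hf] with q hq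
  exact ((trivializationAt F (TangentSpace J) (f p)).linear ℝ hq).map_add (W q) (W' q)

theorem coordAlong_smul_eventuallyEq (hf : ContinuousAt f p) (a : M → ℝ) (W : FieldAlong J f) :
    coordAlong f p (a • W) =ᶠ[𝓝 p] a • coordAlong f p W := by
  filter_upwards [eventually_mem_baseSet (J := J) hf] with q hq
  exact ((trivializationAt F (TangentSpace J) (f p)).linear ℝ hq).map_smul (a q) (W q)

theorem IsDiffAlongAt.comp {Z : Field J N} (hf : MDifferentiableAt I J f p)
    (hZ : MDifferentiableAt J J.tangent (fun y => (⟨y, Z y⟩ : TangentBundle J N)) (f p)) :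
    IsDiffAlongAt I f (fun q => Z (f q)) p :=
  MDifferentiableAt.comp p hZ hf

/-- An operation on fields along `f` that is additive and homogeneous over the differentiable
functions depends only on the value of the field at `p`. -/
theorem eq_of_tensorial_along [FiniteDimensional ℝ F] {A : Type*} [AddCommGroup A] [Module ℝ A]
    (hf : ContMDiff I J ∞ f) (Φ : FieldAlong J f → A)
    (hadd : ∀ W W', IsDiffAlongAt I f W p → IsDiffAlongAt I f W' p → Φ (W + W') = Φ W + Φ W')
    (hsmul : ∀ (a : M → ℝ) W, MDifferentiableAt I 𝓘(ℝ) a p → IsDiffAlongAt I f W p →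
      Φ (a • W) = a p • Φ W)
    {W W' : FieldAlong J f} (hW : IsDiffAlongAt I f W p) (hW' : IsDiffAlongAt I f W' p)
    (h : W p = W' p) : Φ W = Φ W' := by
  -- Fields along `f` are sections of the pull-back bundle `f^* TN`, where the pointwise principle
  -- for tensorial operations applies; both notions of differentiability are read in the same
  -- trivialization.
  let f' : ContMDiffMap I J M N 1 := ⟨f, hf.of_le (by simp)⟩
  let : ∀ x, AddCommGroup (((f' : M → N) *ᵖ (TangentSpace J : N → Type _)) x) :=
    fun x => inferInstanceAs (AddCommGroup (TangentSpace J (f x)))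
  have key : ∀ W : FieldAlong J f,
      MDifferentiableAt I (I.prod 𝓘(ℝ, F)) (fun q => (⟨q, W q⟩ :
        TotalSpace F ((f' : M → N) *ᵖ (TangentSpace J : N → Type _)))) p ↔
      IsDiffAlongAt I f W p := by
    intro W
    rw [isDiffAlongAt_iff (hf.mdifferentiable (by simp) p), mdifferentiableAt_totalSpace]
    exact and_iff_right mdifferentiableAt_id
  have hΦ : TensorialAt I F (V := (f' : M → N) *ᵖ (TangentSpace J : N → Type _)) Φ p :=
    { smul := fun {a σ} ha hσ => hsmul a σ ha ((key σ).1 hσ)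
      add := fun {σ σ'} hσ hσ' => hadd σ σ' ((key σ).1 hσ) ((key σ').1 hσ') }
  exact hΦ.pointwise ((key W).2 hW) ((key W').2 hW') h

section Cov

variable (nablaBar : CovariantDerivative J F (TangentSpace J : N → Type _))

theorem covAlong_apply (W : FieldAlong J f) (p : M) (v : TangentSpace I p) :
    covAlong I nablaBar f W p v =
      (trivializationAt F (TangentSpace J) (f p)).symmL ℝ (f p)
        (mvfderiv I (coordAlong f p W) p v) +
      nablaBar (FiberBundle.extend F (W p)) (f p) (mfderiv I J f p v) := rfl

/-- The derivative in the direction `w` of the coordinate fields, as a linear map. -/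
theorem nablaBar_extend_add (y : N) (v w : TangentSpace J y) :
    nablaBar (FiberBundle.extend F (v + w)) y =
      nablaBar (FiberBundle.extend F v) y + nablaBar (FiberBundle.extend F w) y := by
  rw [← nablaBar.isCovariantDerivativeOnUniv.add
    (FiberBundle.mdifferentiableAt_extend J F v) (FiberBundle.mdifferentiableAt_extend J F w)]
  -- The two fields agree only over the base set of the trivialization, which is enough because the
  -- connection is local.
  refine nablaBar.isCovariantDerivativeOnUniv.congr_of_eventuallyEq
    (FiberBundle.mdifferentiableAt_extend J F _)
    (mdifferentiableAt_add_section (FiberBundle.mdifferentiableAt_extend J F v)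
      (FiberBundle.mdifferentiableAt_extend J F w)) Filter.univ_mem ?_
  filter_upwards [(trivializationAt F (TangentSpace J) y).open_baseSet.mem_nhds
    (FiberBundle.mem_baseSet_trivializationAt' y)] with z hz
  have h := ((trivializationAt F (TangentSpace J) y).linear ℝ
    (FiberBundle.mem_baseSet_trivializationAt' y)).map_add v w
  simp only [FiberBundle.extend, Pi.add_apply]
  rw [h]
  have e := fun c : F => Trivialization.symmₗ_apply (R := ℝ) (trivializationAt F (TangentSpace J) y) hz c
  exact (e _).symm.trans ((map_add _ _ _).trans (congrArg₂ (· + ·) (e _) (e _)))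

theorem nablaBar_extend_smul (y : N) (a : ℝ) (v : TangentSpace J y) :
    nablaBar (FiberBundle.extend F (a • v)) y = a • nablaBar (FiberBundle.extend F v) y := by
  rw [← nablaBar.isCovariantDerivativeOnUniv.smul_const a
    (FiberBundle.mdifferentiableAt_extend J F v)]
  refine nablaBar.isCovariantDerivativeOnUniv.congr_of_eventuallyEq
    (FiberBundle.mdifferentiableAt_extend J F _)
    (MDifferentiableAt.smul_const_section (FiberBundle.mdifferentiableAt_extend J F v))
    Filter.univ_mem ?_
  filter_upwards [(trivializationAt F (TangentSpace J) y).open_baseSet.mem_nhds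
    (FiberBundle.mem_baseSet_trivializationAt' y)] with z hz
  have h := ((trivializationAt F (TangentSpace J) y).linear ℝ
    (FiberBundle.mem_baseSet_trivializationAt' y)).map_smul a v
  simp only [FiberBundle.extend, Pi.smul_apply]
  rw [h]
  have e := fun c : F => Trivialization.symmₗ_apply (R := ℝ) (trivializationAt F (TangentSpace J) y) hz c
  exact (e _).symm.trans ((map_smul _ _ _).trans (congrArg (a • ·) (e _)))

theorem mvfderiv_congr_of_eventuallyEq {w w' : M → F} (h : w =ᶠ[𝓝 p] w') :
    mvfderiv I w p = mvfderiv I w' p := by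
  ext v
  simp only [mvfderiv, h.mfderiv_eq]
  rfl

omit [TopologicalSpace M] in
theorem symmL_coordAlong (W : FieldAlong J f) :
    (trivializationAt F (TangentSpace J) (f p)).symmL ℝ (f p) (coordAlong f p W p) = W p := by
  rw [Trivialization.symmL_apply _ (FiberBundle.mem_baseSet_trivializationAt' (f p))]
  exact (trivializationAt F (TangentSpace J) (f p)).symm_apply_apply_mk
    (FiberBundle.mem_baseSet_trivializationAt' (f p)) (W p)

theorem covAlong_add {W W' : FieldAlong J f} (hW : IsDiffAlongAt I f W p)
    (hW' : IsDiffAlongAt I f W' p) :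
    covAlong I nablaBar f (W + W') p = covAlong I nablaBar f W p + covAlong I nablaBar f W' p := by
  ext v
  rw [_root_.add_apply, covAlong_apply, covAlong_apply, covAlong_apply,
    mvfderiv_congr_of_eventuallyEq (coordAlong_add_eventuallyEq hW.base.continuousAt W W'),
    mvfderiv_add hW.coord hW'.coord, Pi.add_apply, nablaBar_extend_add]
  simp only [_root_.add_apply, map_add]
  abel

/-- The Leibniz term comes from the derivative of the coordinates alone; the connection term sees
only the value of the field at `p` and is linear in it. -/
theorem covAlong_smul {a : M → ℝ} {W : FieldAlong J f} (ha : MDifferentiableAt I 𝓘(ℝ) a p)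
    (hW : IsDiffAlongAt I f W p) (v : TangentSpace I p) :
    covAlong I nablaBar f (a • W) p v =
      a p • covAlong I nablaBar f W p v + mvfderiv I a p v • W p := by
  rw [covAlong_apply, covAlong_apply,
    mvfderiv_congr_of_eventuallyEq (coordAlong_smul_eventuallyEq hW.base.continuousAt a W),
    mvfderiv_smul ha hW.coord, Pi.smul_apply', nablaBar_extend_smul]
  simp only [_root_.add_apply, _root_.smul_apply,
    ContinuousLinearMap.smulRight_apply, map_add, map_smul, symmL_coordAlong]
  module

/-- The coordinates of this field are constant near `p`, so only the connection term survives. This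
is the base case of the tensoriality arguments. -/
theorem covAlong_extend (hf : ContinuousAt f p) (w : TangentSpace J (f p)) (v : TangentSpace I p) :
    covAlong I nablaBar f (fun q => FiberBundle.extend F w (f q)) p v =
      nablaBar (FiberBundle.extend F w) (f p) (mfderiv I J f p v) := by
  have h : coordAlong f p (fun q => FiberBundle.extend F w (f q)) =ᶠ[𝓝 p]
      fun _ => (trivializationAt F (TangentSpace J) (f p) ⟨f p, w⟩).2 := by
    filter_upwards [eventually_mem_baseSet (J := J) hf] with q hq
    have h := (trivializationAt F (TangentSpace J) (f p)).apply_mk_symm hq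
      (trivializationAt F (TangentSpace J) (f p) ⟨f p, w⟩).2
    have h' := congrArg Prod.snd h
    exact h'
  rw [covAlong_apply, mvfderiv_congr_of_eventuallyEq h, mvfderiv_const,
    FiberBundle.extend_apply_self]
  simp

/-- The chain rule `∇̄_v (Z ∘ f) = ∇̄_{df v} Z`. -/
theorem covAlong_comp [FiniteDimensional ℝ F] (hf : MDifferentiableAt I J f p) {Z : Field J N}
    (hZ : MDifferentiableAt J J.tangent (fun y => (⟨y, Z y⟩ : TangentBundle J N)) (f p))
    (v : TangentSpace I p) :
    covAlong I nablaBar f (fun q => Z (f q)) p v = nablaBar Z (f p) (mfderiv I J f p v) := by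
  -- The Leibniz terms of the two sides cancel, so their difference is tensorial in `Z` and can be
  -- tested on `FiberBundle.extend F (Z (f p))`.
  let Φ : Field J N → TangentSpace J (f p) := fun Z =>
    covAlong I nablaBar f (fun q => Z (f q)) p v - nablaBar Z (f p) (mfderiv I J f p v)
  have hΦ : TensorialAt J F Φ (f p) :=
    { smul := by
        intro a σ ha hσ
        have h1 := covAlong_smul (I := I) nablaBar (ha.comp p hf)
          (IsDiffAlongAt.comp hf hσ) v
        have h2 : mvfderiv I (a ∘ f) p v = mvfderiv J a (f p) (mfderiv I J f p v) := by
          rw [mvfderiv_comp_apply _ ha hf]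
        rw [h2] at h1
        have h3 := nablaBar.isCovariantDerivativeOnUniv.leibniz hσ ha
        have h4 : covAlong I nablaBar f (fun q => (a • σ) (f q)) p v = _ := h1
        simp only [Φ]
        rw [h4, h3]
        simp only [_root_.add_apply, _root_.smul_apply,
          ContinuousLinearMap.smulRight_apply, Function.comp_apply]
        module
      add := by
        intro σ σ' hσ hσ'
        have h1 := covAlong_add nablaBar (IsDiffAlongAt.comp hf hσ) (IsDiffAlongAt.comp hf hσ')
        have h3 := nablaBar.isCovariantDerivativeOnUniv.add hσ hσ'
        have h4 : covAlong I nablaBar f (fun q => (σ + σ') (f q)) p = _ := h1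
        simp only [Φ]
        rw [h4, h3]
        simp only [_root_.add_apply]
        abel }
  have h := hΦ.pointwise hZ (FiberBundle.mdifferentiableAt_extend J F (Z (f p)))
    (FiberBundle.extend_apply_self F _).symm
  simp only [Φ] at h
  rw [covAlong_extend nablaBar hf.continuousAt, sub_self, sub_eq_zero] at h
  exact h

end Cov

end Along

/-! ### Smooth vector fields with a prescribed value. -/

section Extension

variable {E : Type*} [NormedAddCommGroup E] [NormedSpace ℝ E] [FiniteDimensional ℝ E]
  {H : Type*} [TopologicalSpace H] {I : ModelWithCorners ℝ E H}
  {M : Type*} [TopologicalSpace M] [T2Space M] [ChartedSpace H M] [IsManifold I ∞ M]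

/-- Every tangent vector is the value of a smooth vector field. -/
theorem exists_isSmoothField (p : M) (v : TangentSpace I p) :
    ∃ X : Field I M, IsSmoothField X ∧ X p = v := by
  obtain ⟨s, hs, hX⟩ := FiberBundle.exists_contMDiffOn_extend (k := ∞) I E v
  -- The local extension is cut off by a bump function supported where it is smooth.
  obtain ⟨ψ, -, hψ⟩ := (SmoothBumpFunction.nhds_basis_tsupport (I := I) p).mem_iff.1
    (interior_mem_nhds.2 hs)
  refine ⟨(ψ : M → ℝ) • FiberBundle.extend E v, ?_, ?_⟩
  · exact ContMDiffOn.smul_section_of_tsupport ψ.contMDiff.contMDiffOn isOpen_interior hψ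
      (hX.mono interior_subset)
  · rw [Pi.smul_apply', ψ.eq_one, one_smul, FiberBundle.extend_apply_self]

omit [FiniteDimensional ℝ E] [T2Space M] in
theorem IsSmoothField.mdifferentiableAt {X : Field I M} (hX : IsSmoothField X) (p : M) :
    MDifferentiableAt I I.tangent (fun q => (⟨q, X q⟩ : TangentBundle I M)) p :=
  ContMDiff.mdifferentiable hX (by simp) p

end Extension

/-! ### Compatibility of the pulled back connection with `g` and `φ`. -/

section Along

variable {E : Type*} [NormedAddCommGroup E] [NormedSpace ℝ E]
  {H : Type*} [TopologicalSpace H] {I : ModelWithCorners ℝ E H}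
  {M : Type*} [TopologicalSpace M] [ChartedSpace H M]
  {F : Type*} [NormedAddCommGroup F] [NormedSpace ℝ F]
  {K : Type*} [TopologicalSpace K] {J : ModelWithCorners ℝ F K}
  {N : Type*} [TopologicalSpace N] [ChartedSpace K N] [IsManifold J ∞ N]
  {f : M → N} {p : M}

theorem IsSmoothAlong.isDiffAlongAt {W : FieldAlong J f} (hW : IsSmoothAlong I f W) (p : M) :
    IsDiffAlongAt I f W p :=
  ContMDiff.mdifferentiable hW (by simp) p

theorem IsDiffAlongAt.endo {φ : EndoField J N}
    (hφ : ContMDiff J (J.prod 𝓘(ℝ, F →L[ℝ] F)) ∞ (fun p => TotalSpace.mk' (F →L[ℝ] F)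
      (E := fun p : N => TangentSpace J p →L[ℝ] TangentSpace J p) p (φ p)))
    {W : FieldAlong J f} (hW : IsDiffAlongAt I f W p) :
    IsDiffAlongAt I f (fun q => φ (f q) (W q)) p :=
  MDifferentiableAt.clm_bundle_apply (ϕ := fun q => φ (f q)) (v := W)
    ((hφ.mdifferentiable (by simp) (f p)).comp p hW.base) hW

theorem IsSmoothAlong.endo {φ : EndoField J N} (hf : ContMDiff I J ∞ f)
    (hφ : ContMDiff J (J.prod 𝓘(ℝ, F →L[ℝ] F)) ∞ (fun p => TotalSpace.mk' (F →L[ℝ] F)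
      (E := fun p : N => TangentSpace J p →L[ℝ] TangentSpace J p) p (φ p)))
    {W : FieldAlong J f} (hW : IsSmoothAlong I f W) :
    IsSmoothAlong I f (fun q => φ (f q) (W q)) :=
  ContMDiff.clm_bundle_apply (ϕ := fun q => φ (f q)) (v := W) (hφ.comp hf) hW

theorem IsDiffAlongAt.metric (g : ContMDiffRiemannianMetric J ∞ F (fun y : N => TangentSpace J y))
    {W Z : FieldAlong J f} (hW : IsDiffAlongAt I f W p) (hZ : IsDiffAlongAt I f Z p) :
    MDifferentiableAt I 𝓘(ℝ) (fun q => g.inner (f q) (W q) (Z q)) p := by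
  have h : MDifferentiableAt I (J.prod 𝓘(ℝ)) (fun q => TotalSpace.mk' ℝ
      (E := Bundle.Trivial N ℝ) (f q) (g.inner (f q) (W q) (Z q))) p :=
    MDifferentiableAt.clm_bundle_apply₂ (F₁ := F) (F₂ := F)
      ((g.contMDiff.mdifferentiable (by simp) (f p)).comp p hW.base) hW hZ
  rw [mdifferentiableAt_totalSpace] at h
  exact h.2

theorem contMDiffAt_metric (g : ContMDiffRiemannianMetric J ∞ F (fun y : N => TangentSpace J y))
    (hf : ContMDiffAt I J ∞ f p) {W Z : FieldAlong J f}
    (hW : ContMDiffAt I J.tangent ∞ (fun q => (⟨f q, W q⟩ : TangentBundle J N)) p)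
    (hZ : ContMDiffAt I J.tangent ∞ (fun q => (⟨f q, Z q⟩ : TangentBundle J N)) p) :
    ContMDiffAt I 𝓘(ℝ) ∞ (fun q => g.inner (f q) (W q) (Z q)) p := by
  have h : ContMDiffAt I (J.prod 𝓘(ℝ)) ∞ (fun q => TotalSpace.mk' ℝ
      (E := Bundle.Trivial N ℝ) (f q) (g.inner (f q) (W q) (Z q))) p :=
    ContMDiffAt.clm_bundle_apply₂ (F₁ := F) (F₂ := F)
      ((g.contMDiff (f p)).comp p hf) hW hZ
  rw [contMDiffAt_totalSpace] at h
  exact h.2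

variable [FiniteDimensional ℝ F] [CompleteSpace F]
  {g : ContMDiffRiemannianMetric J ∞ F (fun y : N => TangentSpace J y)}
  {φ : EndoField J N} {nablaBar : CovariantDerivative J F (TangentSpace J : N → Type _)}

/-- The pulled back Levi-Civita connection is metric. -/
theorem IsLeviCivita.covAlong_metric (hN : IsLeviCivita g.inner nablaBar)
    (hf : ContMDiff I J ∞ f) {W Z : FieldAlong J f} (hW : IsDiffAlongAt I f W p)
    (hZ : IsDiffAlongAt I f Z p) (v : TangentSpace I p) :
    mvfderiv I (fun q => g.inner (f q) (W q) (Z q)) p v =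
      g.inner (f p) (covAlong I nablaBar f W p v) (Z p) +
        g.inner (f p) (W p) (covAlong I nablaBar f Z p v) := by
  have hfp := hf.mdifferentiable (by simp) p
  -- `Φ` is the defect of the identity. Being symmetric, it needs tensoriality only in the first
  -- slot.
  let Φ : FieldAlong J f → FieldAlong J f → ℝ := fun W Z =>
    mvfderiv I (fun q => g.inner (f q) (W q) (Z q)) p v -
      (g.inner (f p) (covAlong I nablaBar f W p v) (Z p) +
        g.inner (f p) (W p) (covAlong I nablaBar f Z p v))
  have hcomm : ∀ W Z, Φ W Z = Φ Z W := by
    intro W Z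
    have h : (fun q => g.inner (f q) (W q) (Z q)) = fun q => g.inner (f q) (Z q) (W q) :=
      funext fun q => g.symm _ _ _
    simp only [Φ]
    rw [h, g.symm (f p) _ (Z p), g.symm (f p) (W p), add_comm]
  have hadd : ∀ Z, IsDiffAlongAt I f Z p → ∀ W W', IsDiffAlongAt I f W p →
      IsDiffAlongAt I f W' p → Φ (W + W') Z = Φ W Z + Φ W' Z := by
    intro Z hZ W W' hW hW'
    have h : (fun q => g.inner (f q) ((W + W') q) (Z q)) =
        (fun q => g.inner (f q) (W q) (Z q)) + fun q => g.inner (f q) (W' q) (Z q) := by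
      funext q
      simp
    simp only [Φ]
    rw [h, mvfderiv_add (hW.metric g hZ) (hW'.metric g hZ), covAlong_add _ hW hW']
    simp only [_root_.add_apply, Pi.add_apply, map_add]
    ring
  have hsmul : ∀ Z, IsDiffAlongAt I f Z p → ∀ (a : M → ℝ) W, MDifferentiableAt I 𝓘(ℝ) a p →
      IsDiffAlongAt I f W p → Φ (a • W) Z = a p • Φ W Z := by
    intro Z hZ a W ha hW
    have h : (fun q => g.inner (f q) ((a • W) q) (Z q)) =
        a • (fun q => g.inner (f q) (W q) (Z q)) := by
      funext q
      simp
    simp only [Φ]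
    rw [h, mvfderiv_smul ha (hW.metric g hZ), covAlong_smul _ ha hW]
    simp only [_root_.add_apply, _root_.smul_apply, Pi.smul_apply', map_add, map_smul, smul_eq_mul,
      ContinuousLinearMap.smulRight_apply]
    ring
  have hext : ∀ w : TangentSpace J (f p),
      IsDiffAlongAt I f (fun q => FiberBundle.extend F w (f q)) p := fun w =>
    IsDiffAlongAt.comp hfp (FiberBundle.mdifferentiableAt_extend J F w)
  have h0 : Φ W Z = 0 := by
    rw [eq_of_tensorial_along hf (Φ · Z) (hadd Z hZ) (hsmul Z hZ) hW (hext (W p))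
      (FiberBundle.extend_apply_self F _).symm, hcomm,
      eq_of_tensorial_along hf (Φ · _) (hadd _ (hext _)) (hsmul _ (hext _)) hZ (hext (Z p))
      (FiberBundle.extend_apply_self F _).symm]
    simp only [Φ]
    rw [covAlong_extend _ hfp.continuousAt, covAlong_extend _ hfp.continuousAt, sub_eq_zero,
      ← hN.metric _ _ (f p) (FiberBundle.mdifferentiableAt_extend J F _)
        (FiberBundle.mdifferentiableAt_extend J F _)]
    -- For pulled back fields the pairing is a function on `N` composed with `f`, so the chain rule
    -- finishes.
    exact mvfderiv_comp_apply _ (IsDiffAlongAt.metric (f := id) g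
      (FiberBundle.mdifferentiableAt_extend J F _)
      (FiberBundle.mdifferentiableAt_extend J F _)) hfp _
  exact sub_eq_zero.1 h0

variable [T2Space N]

/-- On a Kähler manifold `∇φ = 0` holds for all fields that are differentiable at a point. -/
theorem IsKaehler.nablaBar_endo (hN : IsKaehler g φ nablaBar) {y : N} {Z : Field J N}
    (hZ : MDifferentiableAt J J.tangent (fun y => (⟨y, Z y⟩ : TangentBundle J N)) y)
    (v : TangentSpace J y) :
    nablaBar (fun z => φ z (Z z)) y v = φ y (nablaBar Z y v) := by
  have hφ : ∀ {Z : Field J N},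
      MDifferentiableAt J J.tangent (fun y => (⟨y, Z y⟩ : TangentBundle J N)) y →
      MDifferentiableAt J J.tangent (fun z => (⟨z, φ z (Z z)⟩ : TangentBundle J N)) y :=
    fun hZ => IsDiffAlongAt.endo (f := id) hN.almostHermitian.smooth hZ
  let Φ : Field J N → TangentSpace J y := fun Z =>
    nablaBar (fun z => φ z (Z z)) y v - φ y (nablaBar Z y v)
  have hΦ : TensorialAt J F Φ y :=
    { smul := by
        intro a σ ha hσ
        have h : (fun z => φ z ((a • σ) z)) = a • fun z => φ z (σ z) := by
          funext z
          simp
        simp only [Φ]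
        rw [h, nablaBar.isCovariantDerivativeOnUniv.leibniz hσ ha,
          nablaBar.isCovariantDerivativeOnUniv.leibniz (hφ hσ) ha]
        simp only [_root_.add_apply, _root_.smul_apply, ContinuousLinearMap.smulRight_apply,
          map_add, map_smul]
        module
      add := by
        intro σ σ' hσ hσ'
        have h : (fun z => φ z ((σ + σ') z)) = (fun z => φ z (σ z)) + fun z => φ z (σ' z) := by
          funext z
          simp
        simp only [Φ]
        rw [h, nablaBar.isCovariantDerivativeOnUniv.add hσ hσ',
          nablaBar.isCovariantDerivativeOnUniv.add (hφ hσ) (hφ hσ')]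
        simp only [_root_.add_apply, map_add]
        abel }
  -- Parallelism is assumed for global smooth fields only; tensoriality lets such a field with the
  -- same value at `y` replace `Z`.
  obtain ⟨Y, hY, hYy⟩ := exists_isSmoothField y (Z y)
  obtain ⟨X, hX, hXy⟩ := exists_isSmoothField y v
  have h := hΦ.pointwise hZ (hY.mdifferentiableAt y) hYy.symm
  have h0 := hN.parallel X Y hX hY y
  simp only [Φ] at h
  rw [hXy] at h0
  rwa [h0, sub_self, sub_eq_zero] at h

/-- On a Kähler manifold the pulled back connection commutes with `φ`. -/
theorem IsKaehler.covAlong_endo (hN : IsKaehler g φ nablaBar) (hf : ContMDiff I J ∞ f)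
    {W : FieldAlong J f} (hW : IsDiffAlongAt I f W p) (v : TangentSpace I p) :
    covAlong I nablaBar f (fun q => φ (f q) (W q)) p v =
      φ (f p) (covAlong I nablaBar f W p v) := by
  have hfp := hf.mdifferentiable (by simp) p
  have hφ := hN.almostHermitian.smooth
  let Φ : FieldAlong J f → TangentSpace J (f p) := fun W =>
    covAlong I nablaBar f (fun q => φ (f q) (W q)) p v - φ (f p) (covAlong I nablaBar f W p v)
  have hadd : ∀ W W', IsDiffAlongAt I f W p → IsDiffAlongAt I f W' p →
      Φ (W + W') = Φ W + Φ W' := by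
    intro W W' hW hW'
    have h : (fun q => φ (f q) ((W + W') q)) =
        ((fun q => φ (f q) (W q) : FieldAlong J f) + fun q => φ (f q) (W' q)) := by
      funext q
      simp
    simp only [Φ]
    rw [h, covAlong_add _ hW hW', covAlong_add _ (hW.endo hφ) (hW'.endo hφ)]
    simp only [_root_.add_apply, map_add]
    abel
  have hsmul : ∀ (a : M → ℝ) W, MDifferentiableAt I 𝓘(ℝ) a p → IsDiffAlongAt I f W p →
      Φ (a • W) = a p • Φ W := by
    intro a W ha hW
    have h : (fun q => φ (f q) ((a • W) q)) = (a • (fun q => φ (f q) (W q) : FieldAlong J f)) := by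
      funext q
      simp
    simp only [Φ]
    rw [h, covAlong_smul _ ha hW, covAlong_smul _ ha (hW.endo hφ)]
    simp only [map_add, map_smul]
    module
  have hZ := FiberBundle.mdifferentiableAt_extend J F (W p)
  have h := eq_of_tensorial_along hf Φ hadd hsmul hW (IsDiffAlongAt.comp hfp hZ)
    (FiberBundle.extend_apply_self F _).symm
  -- `φ` applied to an extension no longer has constant coordinates, hence the chain rule for
  -- arbitrary differentiable fields.
  have h1 : covAlong I nablaBar f (fun q => φ (f q) (FiberBundle.extend F (W p) (f q))) p v =
      nablaBar (fun z => φ z (FiberBundle.extend F (W p) z)) (f p) (mfderiv I J f p v) :=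
    covAlong_comp nablaBar hfp (IsDiffAlongAt.endo (f := id) hφ hZ) v
  simp only [Φ] at h
  rwa [h1, hN.nablaBar_endo hZ, covAlong_extend _ hfp.continuousAt, sub_self, sub_eq_zero] at h

end Along

/-! ### Chain rules for vector-valued functions. -/

section ChainRule

variable {E : Type*} [NormedAddCommGroup E] [NormedSpace ℝ E]
  {H : Type*} [TopologicalSpace H] {I : ModelWithCorners ℝ E H}
  {M : Type*} [TopologicalSpace M] [ChartedSpace H M]
  {F : Type*} [NormedAddCommGroup F] [NormedSpace ℝ F]
  {K : Type*} [TopologicalSpace K] {J : ModelWithCorners ℝ F K}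
  {N : Type*} [TopologicalSpace N] [ChartedSpace K N]
  {G : Type*} [NormedAddCommGroup G] [NormedSpace ℝ G] {p : M}

theorem mvfderiv_comp_mfderiv {g : N → G} {f : M → N} (hg : MDifferentiableAt J 𝓘(ℝ, G) g (f p))
    (hf : MDifferentiableAt I J f p) (v : TangentSpace I p) :
    mvfderiv I (g ∘ f) p v = mvfderiv J g (f p) (mfderiv I J f p v) :=
  mfderiv_comp_apply p hg hf v

theorem mvfderiv_comp_fderiv {g : F → G} {f : M → F} (hg : DifferentiableAt ℝ g (f p))
    (hf : MDifferentiableAt I 𝓘(ℝ, F) f p) (v : TangentSpace I p) :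
    mvfderiv I (g ∘ f) p v = fderiv ℝ g (f p) (mvfderiv I f p v) := by
  rw [mvfderiv_comp_mfderiv hg.mdifferentiableAt hf]
  simp only [mvfderiv, mfderiv_eq_fderiv]
  rfl

end ChainRule

/-! ### The Lie bracket as a commutator of derivations. -/

section Bracket

open VectorField

variable {E : Type*} [NormedAddCommGroup E] [NormedSpace ℝ E] [CompleteSpace E]
  {H : Type*} [TopologicalSpace H] {I : ModelWithCorners ℝ E H} [I.Boundaryless]
  {M : Type*} [TopologicalSpace M] [ChartedSpace H M] [IsManifold I ∞ M]
  {G : Type*} [NormedAddCommGroup G] [NormedSpace ℝ G] {p : M}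

variable (I) in
/-- The vector field `X` in the chart at `p`. -/
def chartField (p : M) (X : Field I M) : E → E :=
  mpullbackWithin 𝓘(ℝ, E) I (extChartAt I p).symm X (Set.range I)

theorem chartField_differentiableAt {X : Field I M}
    (hX : MDifferentiableAt I I.tangent (fun q => (⟨q, X q⟩ : TangentBundle I M)) p) :
    DifferentiableAt ℝ (chartField I p X) (extChartAt I p p) := by
  have h := MDifferentiableWithinAt.differentiableWithinAt_mpullbackWithin_vectorField (I := I)
    (mdifferentiableWithinAt_univ.2 hX)
  change DifferentiableWithinAt ℝ (chartField I p X) _ _ at h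
  rwa [Set.preimage_univ, Set.univ_inter, I.range_eq_univ, differentiableWithinAt_univ] at h

omit [CompleteSpace E] [I.Boundaryless] in
theorem chartField_extChartAt (X : Field I M) {q : M} (hq : q ∈ (extChartAt I p).source) :
    chartField I p X (extChartAt I p q) = mvfderiv I (extChartAt I p) q (X q) := by
  have h1 := mfderivWithin_extChartAt_symm_comp_mfderiv_extChartAt' (I := I) hq
  have h2 := mfderiv_extChartAt_comp_mfderivWithin_extChartAt_symm' (I := I) hq
  have h3 : (X ((extChartAt I p).symm (extChartAt I p q)) : E) = (X q : E) :=
    congrArg (fun z => (X z : E)) ((extChartAt I p).left_inv hq)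
  have h4 : ContinuousLinearMap.inverse
      (mfderivWithin 𝓘(ℝ, E) I (extChartAt I p).symm (Set.range I) (extChartAt I p q) : E →L[ℝ] E)
      = (mfderiv I 𝓘(ℝ, E) (extChartAt I p) q : E →L[ℝ] E) :=
    ContinuousLinearMap.inverse_eq h1 h2
  have h5 := DFunLike.congr_fun h4 (X q : E)
  rw [← h3] at h5
  refine Eq.trans h5 ?_
  rw [h3]
  rfl

-- The chart at `p` has the identity as its differential at `p`, so transporting the bracket back
-- from the chart changes nothing.
omit [CompleteSpace E] in
theorem mlieBracket_eq_lieBracket_chartField (X Y : Field I M) :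
    (mlieBracket I X Y p : E) =
      lieBracket ℝ (chartField I p X) (chartField I p Y) (extChartAt I p p) := by
  have h : (mlieBracket I X Y p : E) =
      ContinuousLinearMap.inverse (mfderiv I 𝓘(ℝ, E) (extChartAt I p) p : E →L[ℝ] E)
      (lieBracketWithin ℝ (chartField I p X) (chartField I p Y)
        ((extChartAt I p).symm ⁻¹' Set.univ ∩ Set.range I) (extChartAt I p p) : E) := rfl
  have h1 : (mfderiv I 𝓘(ℝ, E) (extChartAt I p) p : E →L[ℝ] E) = ContinuousLinearMap.id ℝ E :=
    mfderiv_extChartAt_self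
  have h2 : ContinuousLinearMap.inverse (mfderiv I 𝓘(ℝ, E) (extChartAt I p) p : E →L[ℝ] E) =
      ContinuousLinearMap.id ℝ E :=
    (congrArg ContinuousLinearMap.inverse h1).trans ContinuousLinearMap.inverse_id
  rw [Set.preimage_univ, Set.univ_inter, I.range_eq_univ, lieBracketWithin_univ] at h
  exact h.trans (DFunLike.congr_fun h2 _)

omit [CompleteSpace E] in
theorem mvfderiv_apply_eventuallyEq {u : M → G} (hu : ContMDiffAt I 𝓘(ℝ, G) ∞ u p)
    (Y : Field I M) :
    (fun q => mvfderiv I u q (Y q)) =ᶠ[𝓝 p] fun q =>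
      fderiv ℝ (u ∘ (extChartAt I p).symm) (extChartAt I p q)
        (chartField I p Y (extChartAt I p q)) := by
  -- Being `C^∞` at `p` need not persist at nearby points, but being `C^1` does.
  have hu1 : ∀ᶠ q in 𝓝 p, ContMDiffAt I 𝓘(ℝ, G) 1 u q :=
    (contMDiffAt_iff_contMDiffAt_nhds (by simp)).1 (ContMDiffAt.of_le hu (m := 1) (by simp))
  filter_upwards [hu1, extChartAt_source_mem_nhds (I := I) p] with q hq hqs
  have hqs' : q ∈ (chartAt H p).source := by rwa [extChartAt_source] at hqs
  rw [chartField_extChartAt Y hqs]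
  have hc : MDifferentiableAt I 𝓘(ℝ, E) (extChartAt I p) q := mdifferentiableAt_extChartAt hqs'
  have hs : MDifferentiableAt 𝓘(ℝ, E) I (extChartAt I p).symm (extChartAt I p q) := by
    have := mdifferentiableWithinAt_extChartAt_symm (I := I) ((extChartAt I p).map_source hqs)
    rwa [I.range_eq_univ, mdifferentiableWithinAt_univ] at this
  have hv : MDifferentiableAt 𝓘(ℝ, E) 𝓘(ℝ, G) (u ∘ (extChartAt I p).symm) (extChartAt I p q) := by
    refine MDifferentiableAt.comp (I' := I) _ ?_ hs
    rw [(extChartAt I p).left_inv hqs]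
    exact hq.mdifferentiableAt (by simp)
  have he : u =ᶠ[𝓝 q] (u ∘ (extChartAt I p).symm) ∘ extChartAt I p := by
    filter_upwards [(isOpen_extChartAt_source (I := I) p).mem_nhds hqs] with z hz
    simp only [Function.comp_apply, (extChartAt I p).left_inv hz]
  rw [mvfderiv_congr_of_eventuallyEq he, mvfderiv_comp_fderiv hv.differentiableAt hc]

theorem hasFDerivAt_fderiv_apply {E G : Type*} [NormedAddCommGroup E] [NormedSpace ℝ E]
    [NormedAddCommGroup G] [NormedSpace ℝ G] {u : E → G} {Y : E → E} {x : E} (hu : ContDiffAt ℝ ∞ u x)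
    (hY : DifferentiableAt ℝ Y x) :
    HasFDerivAt (fun y => fderiv ℝ u y (Y y))
      ((fderiv ℝ u x).comp (fderiv ℝ Y x) + (fderiv ℝ (fderiv ℝ u) x).flip (Y x)) x :=
  (((hu.fderiv_right (m := 1) (WithTop.coe_le_coe.2 le_top)).differentiableAt (by simp)).hasFDerivAt).clm_apply
    hY.hasFDerivAt

/-- The bracket of vector fields acts on functions as the commutator of derivations. -/
theorem mvfderiv_mlieBracket {u : M → G} (hu : ContMDiffAt I 𝓘(ℝ, G) ∞ u p) {X Y : Field I M}
    (hX : MDifferentiableAt I I.tangent (fun q => (⟨q, X q⟩ : TangentBundle I M)) p)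
    (hY : MDifferentiableAt I I.tangent (fun q => (⟨q, Y q⟩ : TangentBundle I M)) p) :
    mvfderiv I u p (mlieBracket I X Y p) =
      mvfderiv I (fun q => mvfderiv I u q (Y q)) p (X p) -
        mvfderiv I (fun q => mvfderiv I u q (X q)) p (Y p) := by
  set c := extChartAt I p
  set v : E → G := u ∘ c.symm
  have hv : ContDiffAt ℝ ∞ v (c p) := by
    have h := contMDiffAt_iff_source.1 hu
    rw [I.range_eq_univ, contMDiffWithinAt_univ] at h
    exact h.contDiffAt
  have hps : p ∈ c.source := mem_extChartAt_source p
  have hc : MDifferentiableAt I 𝓘(ℝ, E) c p := mdifferentiableAt_extChartAt (mem_chart_source H p)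
  -- In the chart, `X(Y u)` is a first-order term plus the Hessian of `u` on `X` and `Y`; the
  -- Hessian is symmetric and drops out of the commutator.
  have key : ∀ {Y : Field I M},
      MDifferentiableAt I I.tangent (fun q => (⟨q, Y q⟩ : TangentBundle I M)) p →
      ∀ X : Field I M, mvfderiv I (fun q => mvfderiv I u q (Y q)) p (X p) =
        fderiv ℝ v (c p) (fderiv ℝ (chartField I p Y) (c p) (chartField I p X (c p))) +
          fderiv ℝ (fderiv ℝ v) (c p) (chartField I p X (c p)) (chartField I p Y (c p)) := by
    intro Y hY X
    have hd := hasFDerivAt_fderiv_apply hv (chartField_differentiableAt hY)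
    have he := mvfderiv_apply_eventuallyEq hu Y
    have h1 := mvfderiv_comp_fderiv (g := fun y => fderiv ℝ v y (chartField I p Y y))
      hd.differentiableAt hc (X p)
    rw [mvfderiv_congr_of_eventuallyEq he]
    refine h1.trans ?_
    rw [← chartField_extChartAt X hps, hd.fderiv]
    rfl
  have hB : mvfderiv I u p (mlieBracket I X Y p) = fderiv ℝ v (c p)
      (lieBracket ℝ (chartField I p X) (chartField I p Y) (c p)) := by
    obtain ⟨Z, hZ⟩ : ∃ Z : Field I M, Z p = mlieBracket I X Y p := ⟨mlieBracket I X Y, rfl⟩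
    have h := (mvfderiv_apply_eventuallyEq hu Z).self_of_nhds
    simp only [hZ] at h
    have h1 : mvfderiv I c p (mlieBracket I X Y p) = mlieBracket I X Y p := by
      simp only [mvfderiv, c, mfderiv_extChartAt_self]
      rfl
    rw [h, chartField_extChartAt Z hps, hZ, h1, mlieBracket_eq_lieBracket_chartField]
  have hsymm : IsSymmSndFDerivAt ℝ v (c p) := hv.isSymmSndFDerivAt
    (by rw [minSmoothness_of_isRCLikeNormedField]; exact WithTop.coe_le_coe.2 le_top)
  rw [hB, key hY X, key hX Y, hsymm.eq, lieBracket_eq]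
  simp only [map_sub]
  abel

end Bracket

/-! ### The pulled back connection is torsion free. -/

section Torsion

open VectorField

variable {E : Type*} [NormedAddCommGroup E] [NormedSpace ℝ E] [CompleteSpace E]
  {H : Type*} [TopologicalSpace H] {I : ModelWithCorners ℝ E H} [I.Boundaryless]
  {M : Type*} [TopologicalSpace M] [ChartedSpace H M] [IsManifold I ∞ M]
  {F : Type*} [NormedAddCommGroup F] [NormedSpace ℝ F]
  {K : Type*} [TopologicalSpace K] {J : ModelWithCorners ℝ F K}
  {N : Type*} [TopologicalSpace N] [ChartedSpace K N] [IsManifold J ∞ N]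
  {f : M → N} {p : M}

-- The trivialization of `TN` at `f p` is the differential of the chart at `f p`, so reading `df Y`
-- in it amounts to differentiating `f` in that chart.
omit [CompleteSpace E] [I.Boundaryless] [IsManifold I ∞ M] in
theorem coordAlong_mfderiv_eventuallyEq (hf : ContMDiff I J ∞ f) (Y : Field I M) :
    coordAlong f p (fun q => mfderiv I J f q (Y q)) =ᶠ[𝓝 p]
      fun q => mvfderiv I (extChartAt J (f p) ∘ f) q (Y q) := by
  have hs : ∀ᶠ q in 𝓝 p, f q ∈ (chartAt K (f p)).source :=
    hf.continuous.continuousAt (chart_source_mem_nhds K (f p))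
  filter_upwards [hs] with q hq
  have h := DFunLike.congr_fun (TangentBundle.continuousLinearMapAt_trivializationAt (I := J) hq)
    (mfderiv I J f q (Y q))
  refine Eq.trans ?_ (h.trans (mvfderiv_comp_mfderiv (mdifferentiableAt_extChartAt hq)
    (hf.mdifferentiable (by simp) q) (Y q)).symm)
  rw [Trivialization.continuousLinearMapAt_apply, Trivialization.linearMapAt_apply,
    if_pos (by simpa using hq)]
  rfl

omit [CompleteSpace E] [I.Boundaryless] [IsManifold I ∞ M] [IsManifold J ∞ N] in
theorem contMDiffAt_extChartAt_comp (hf : ContMDiff I J ∞ f) :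
    ContMDiffAt I 𝓘(ℝ, F) ∞ (extChartAt J (f p) ∘ f) p :=
  contMDiffAt_extChartAt.comp p (hf p)

omit [CompleteSpace E] [I.Boundaryless] [IsManifold I ∞ M] in
theorem symmL_mvfderiv_extChartAt_comp (hf : ContMDiff I J ∞ f) (v : TangentSpace I p) :
    (trivializationAt F (TangentSpace J) (f p)).symmL ℝ (f p)
      (mvfderiv I (extChartAt J (f p) ∘ f) p v) = mfderiv I J f p v := by
  -- All tangent spaces are the model space `E`, so `v` itself defines a field with value `v` at
  -- `p`; only that value is used.
  have h := (coordAlong_mfderiv_eventuallyEq (p := p) hf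
    (fun q => (show TangentSpace I q from (v : E)))).self_of_nhds
  rw [← symmL_coordAlong (fun q => mfderiv I J f q (show TangentSpace I q from (v : E)))]
  exact congrArg _ h.symm

variable [J.Boundaryless] [FiniteDimensional ℝ F] [CompleteSpace F]
  {nablaBar : CovariantDerivative J F (TangentSpace J : N → Type _)}

-- The chart has constant derivative along each such field, so both iterated derivatives in the
-- commutator vanish, and the differential of the chart at `y` is the identity.
omit [FiniteDimensional ℝ F] in
theorem mlieBracket_extend (y : N) (v w : TangentSpace J y) :
    mlieBracket J (FiberBundle.extend F v) (FiberBundle.extend F w) y = 0 := by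
  have h0 : ∀ a b : TangentSpace J y, mvfderiv J (fun q => mvfderiv J (extChartAt J y) q
      (FiberBundle.extend F a q)) y b = 0 := by
    intro a b
    have h : (fun q => mvfderiv J (extChartAt J y) q (FiberBundle.extend F a q)) =ᶠ[𝓝 y]
        fun _ => (trivializationAt F (TangentSpace J) y ⟨y, a⟩).2 := by
      filter_upwards [coordAlong_mfderiv_eventuallyEq (I := J) (J := J) (p := y) (f := id)
        contMDiff_id (FiberBundle.extend F a),
        eventually_mem_baseSet (J := J) (f := id) (p := y) continuousAt_id] with q hq hb
      refine hq.symm.trans ?_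
      have h1 := (trivializationAt F (TangentSpace J) y).apply_mk_symm hb
        (trivializationAt F (TangentSpace J) y ⟨y, a⟩).2
      have h2 := congrArg Prod.snd h1
      have h3 : mfderiv J J id q (FiberBundle.extend F a q) = FiberBundle.extend F a q := by
        rw [mfderiv_id]
        rfl
      simp only [coordAlong]
      rw [h3]
      exact h2
    rw [mvfderiv_congr_of_eventuallyEq h, mvfderiv_const]
    rfl
  have h := mvfderiv_mlieBracket (I := J) (contMDiffAt_extChartAt (n := ∞) (x := y))
    (FiberBundle.mdifferentiableAt_extend J F v) (FiberBundle.mdifferentiableAt_extend J F w)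
  rw [h0, h0, sub_zero] at h
  have h4 : mvfderiv J (extChartAt J y) y (mlieBracket J (FiberBundle.extend F v)
      (FiberBundle.extend F w) y) = mlieBracket J (FiberBundle.extend F v)
      (FiberBundle.extend F w) y := by
    simp only [mvfderiv, mfderiv_extChartAt_self]
    rfl
  exact h4.symm.trans h

/-- The pulled back Levi-Civita connection is torsion free:
`∇̄_X (df Y) - ∇̄_Y (df X) = df [X, Y]`. -/
theorem covAlong_mfderiv_sub (hN : nablaBar.torsion = 0) (hf : ContMDiff I J ∞ f)
    {X Y : Field I M}
    (hX : MDifferentiableAt I I.tangent (fun q => (⟨q, X q⟩ : TangentBundle I M)) p)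
    (hY : MDifferentiableAt I I.tangent (fun q => (⟨q, Y q⟩ : TangentBundle I M)) p) :
    covAlong I nablaBar f (fun q => mfderiv I J f q (Y q)) p (X p) -
      covAlong I nablaBar f (fun q => mfderiv I J f q (X q)) p (Y p) =
      mfderiv I J f p (mlieBracket I X Y p) := by
  -- Extensions have vanishing bracket at `f p`, so zero torsion makes the connection terms
  -- symmetric and they cancel. What remains is the commutator of `X` and `Y` acting on `f` in the
  -- chart.
  have ht := nablaBar.torsion_eq_zero_iff.1 hN
    (FiberBundle.mdifferentiableAt_extend J F (mfderiv I J f p (X p)))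
    (FiberBundle.mdifferentiableAt_extend J F (mfderiv I J f p (Y p)))
  rw [mlieBracket_extend, FiberBundle.extend_apply_self, FiberBundle.extend_apply_self,
    sub_eq_zero] at ht
  rw [covAlong_apply, covAlong_apply, ht,
    mvfderiv_congr_of_eventuallyEq (coordAlong_mfderiv_eventuallyEq hf X),
    mvfderiv_congr_of_eventuallyEq (coordAlong_mfderiv_eventuallyEq hf Y),
    add_sub_add_right_eq_sub, ← map_sub,
    ← mvfderiv_mlieBracket (contMDiffAt_extChartAt_comp hf) hX hY,
    symmL_mvfderiv_extChartAt_comp hf]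

end Torsion

/-! ### Linear maps on finite-dimensional spaces. -/

section Linear

/-- Positivity makes `B` injective, and a space and its dual have equal dimension. -/
theorem isInvertible_of_pos {E : Type*} [NormedAddCommGroup E] [NormedSpace ℝ E]
    [FiniteDimensional ℝ E] (B : E →L[ℝ] E →L[ℝ] ℝ) (hB : ∀ v, v ≠ 0 → 0 < B v v) :
    B.IsInvertible := by
  have hinj : Function.Injective (B : E →ₗ[ℝ] E →L[ℝ] ℝ) := by
    rw [← LinearMap.ker_eq_bot, LinearMap.ker_eq_bot']
    intro v hv
    by_contra h
    have h1 := hB v h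
    have h2 : B v = 0 := hv
    simp [h2] at h1
  have hfin : Module.finrank ℝ E = Module.finrank ℝ (E →L[ℝ] ℝ) := by
    rw [← Subspace.dual_finrank_eq]
    exact LinearEquiv.finrank_eq LinearMap.toContinuousLinearMap
  exact ⟨(LinearMap.linearEquivOfInjective (B : E →ₗ[ℝ] E →L[ℝ] ℝ) hinj
    hfin).toContinuousLinearEquiv, by ext; rfl⟩

/-- In a basis, `A` is a finite sum of rank-one operators depending linearly on the values at the
basis vectors. -/
theorem contMDiffAt_clm_of_apply {D H M E G : Type*} [NormedAddCommGroup D] [NormedSpace ℝ D]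
    [TopologicalSpace H] {I : ModelWithCorners ℝ D H} [TopologicalSpace M] [ChartedSpace H M]
    [NormedAddCommGroup E] [NormedSpace ℝ E] [FiniteDimensional ℝ E]
    [NormedAddCommGroup G] [NormedSpace ℝ G] {n : ℕ∞ω} {A : M → E →L[ℝ] G} {p : M}
    (hA : ∀ v, ContMDiffAt I 𝓘(ℝ, G) n (fun q => A q v) p) :
    ContMDiffAt I 𝓘(ℝ, E →L[ℝ] G) n A p := by
  let b := Module.finBasis ℝ E
  have h : A = fun q => ∑ i, ContinuousLinearMap.smulRightL ℝ E G
      (LinearMap.toContinuousLinearMap (b.coord i)) (A q (b i)) := by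
    funext q
    refine ContinuousLinearMap.ext fun v => ?_
    conv_lhs => rw [← b.sum_repr v, map_sum]
    simp
  rw [h]
  refine ContMDiffAt.sum fun i _ => ?_
  exact (ContinuousLinearMap.contDiff _).contDiffAt.comp_contMDiffAt (hA (b i))

end Linear

/-! ### Tangential and normal projections and their smoothness. -/

section Tangential

variable {E : Type*} [NormedAddCommGroup E] [NormedSpace ℝ E] [FiniteDimensional ℝ E]
  {H : Type*} [TopologicalSpace H] {I : ModelWithCorners ℝ E H}
  {M : Type*} [TopologicalSpace M] [ChartedSpace H M]
  {F : Type*} [NormedAddCommGroup F] [NormedSpace ℝ F]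
  {K : Type*} [TopologicalSpace K] {J : ModelWithCorners ℝ F K}
  {N : Type*} [TopologicalSpace N] [ChartedSpace K N] [IsManifold J ∞ N]
  {g : ContMDiffRiemannianMetric J ∞ F (fun y : N => TangentSpace J y)}
  {f : M → N} {p : M}

omit [FiniteDimensional ℝ E] in
theorem inducedMetric_apply (v w : TangentSpace I p) :
    inducedMetric I g f p v w = g.inner (f p) (mfderiv I J f p v) (mfderiv I J f p w) := rfl

omit [FiniteDimensional ℝ E] in
theorem inducedMetric_pos (himm : Function.Injective (mfderiv I J f p)) {v : TangentSpace I p}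
    (hv : v ≠ 0) : 0 < inducedMetric I g f p v v :=
  g.pos _ _ ((map_ne_zero_iff _ himm).2 hv)

theorem inducedMetric_isInvertible (himm : Function.Injective (mfderiv I J f p)) :
    (inducedMetric I g f p).IsInvertible :=
  isInvertible_of_pos (E := E) (inducedMetric I g f p) fun _ hv => inducedMetric_pos himm hv

theorem inducedMetric_tangential (himm : Function.Injective (mfderiv I J f p))
    (w : TangentSpace J (f p)) (v : TangentSpace I p) :
    inducedMetric I g f p (tangential I g f p w) v = g.inner (f p) w (mfderiv I J f p v) := by
  have h := (inducedMetric_isInvertible (g := g) himm).self_apply_inverse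
    (((ContinuousLinearMap.precomp ℝ (mfderiv I J f p)).comp (g.inner (f p))) w)
  exact DFunLike.congr_fun h v

omit [FiniteDimensional ℝ E] in
theorem eq_of_inducedMetric_eq (himm : Function.Injective (mfderiv I J f p))
    {u u' : TangentSpace I p} (h : ∀ v, inducedMetric I g f p u v = inducedMetric I g f p u' v) :
    u = u' := by
  by_contra hne
  have h1 := inducedMetric_pos (g := g) himm (sub_ne_zero.2 hne)
  rw [(inducedMetric I g f p).map_sub, _root_.sub_apply, h, sub_self] at h1
  exact lt_irrefl _ h1

theorem tangential_eq (himm : Function.Injective (mfderiv I J f p)) {w : TangentSpace J (f p)}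
    {u : TangentSpace I p}
    (h : ∀ v, inducedMetric I g f p u v = g.inner (f p) w (mfderiv I J f p v)) :
    tangential I g f p w = u :=
  eq_of_inducedMetric_eq himm fun v => (inducedMetric_tangential himm w v).trans (h v).symm

theorem tangential_eq_zero (himm : Function.Injective (mfderiv I J f p))
    {w : TangentSpace J (f p)} (h : ∀ v, g.inner (f p) w (mfderiv I J f p v) = 0) :
    tangential I g f p w = 0 :=
  tangential_eq himm fun v => by rw [h, map_zero]; rfl

omit [FiniteDimensional ℝ E] in
theorem mfderiv_tangential_add_normal (w : TangentSpace J (f p)) :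
    mfderiv I J f p (tangential I g f p w) + normal I g f p w = w := by
  simp [normal]

theorem inner_normal_mfderiv (himm : Function.Injective (mfderiv I J f p))
    (w : TangentSpace J (f p)) (v : TangentSpace I p) :
    g.inner (f p) (normal I g f p w) (mfderiv I J f p v) = 0 := by
  have h := inducedMetric_tangential (g := g) himm w v
  rw [inducedMetric_apply] at h
  have h1 : normal I g f p w = w - mfderiv I J f p (tangential I g f p w) := rfl
  rw [h1, map_sub, _root_.sub_apply, h, sub_self]

variable [IsManifold I ∞ M]

omit [FiniteDimensional ℝ E] in
theorem contMDiffAt_mfderiv (hf : ContMDiff I J ∞ f) {Y : Field I M}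
    (hY : ContMDiffAt I I.tangent ∞ (fun q => (⟨q, Y q⟩ : TangentBundle I M)) p) :
    ContMDiffAt I J.tangent ∞ (fun q => (⟨f q, mfderiv I J f q (Y q)⟩ : TangentBundle J N)) p :=
  ContMDiffAt.comp p ((hf.contMDiff_tangentMap (m := ∞) (by simp)) _) hY

omit [FiniteDimensional ℝ E] in
theorem IsSmoothField.mfderiv (hf : ContMDiff I J ∞ f) {Y : Field I M} (hY : IsSmoothField Y) :
    IsSmoothAlong I f (fun q => mfderiv I J f q (Y q)) :=
  fun q => contMDiffAt_mfderiv hf (hY q)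

variable (I) in
/-- The field that has constant coordinates `v` in the standard trivialization at `p`. -/
def constField (p : M) (v : E) : Field I M := fun q =>
  (trivializationAt E (TangentSpace I) p).symmL ℝ q v

omit [FiniteDimensional ℝ E] in
theorem trivializationAt_constField {q : M}
    (hq : q ∈ (trivializationAt E (TangentSpace I) p).baseSet) (v : E) :
    (trivializationAt E (TangentSpace I) p ⟨q, constField I p v q⟩).2 = v := by
  have h := congrArg Prod.snd ((trivializationAt E (TangentSpace I) p).apply_mk_symm hq v)
  rw [constField, Trivialization.symmL_apply _ hq]
  exact h

omit [FiniteDimensional ℝ E] in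
theorem exists_constField_eq {q : M}
    (hq : q ∈ (trivializationAt E (TangentSpace I) p).baseSet) (v : TangentSpace I q) :
    ∃ a, constField I p a q = v :=
  ⟨_, (trivializationAt E (TangentSpace I) p).symmL_continuousLinearMapAt (R := ℝ) hq v⟩

omit [FiniteDimensional ℝ E] in
theorem contMDiffAt_constField (v : E) :
    ContMDiffAt I I.tangent ∞ (fun q => (⟨q, constField I p v q⟩ : TangentBundle I M)) p := by
  refine (contMDiffAt_section p).2 ((contMDiffAt_const (c := v)).congr_of_eventuallyEq ?_)
  filter_upwards [(trivializationAt E (TangentSpace I) p).open_baseSet.mem_nhds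
    (FiberBundle.mem_baseSet_trivializationAt' p)] with q hq
  exact trivializationAt_constField hq v

/-- The tangential component of a smooth field along an immersion is smooth. -/
theorem IsSmoothAlong.tangential (hf : ContMDiff I J ∞ f)
    (himm : ∀ p : M, Function.Injective (mfderiv I J f p)) {W : FieldAlong J f}
    (hW : IsSmoothAlong I f W) : IsSmoothField (fun q => tangential I g f q (W q)) := by
  intro p
  let t := trivializationAt E (TangentSpace I) p
  -- `B` is the Gram form of the induced metric in a local frame and `β` the covector `g(W, df ·)`.
  -- The coordinates of the tangential part solve `B z = β`, so they are smooth because inversion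
  -- is.
  let B : M → E →L[ℝ] E →L[ℝ] ℝ := fun q =>
    (ContinuousLinearMap.precomp ℝ (t.symmL ℝ q)).comp
      ((inducedMetric I g f q).comp (t.symmL ℝ q))
  let β : M → E →L[ℝ] ℝ := fun q =>
    (g.inner (f q) (W q)).comp ((mfderiv I J f q).comp (t.symmL ℝ q))
  have hdf : ∀ v, ContMDiffAt I J.tangent ∞
      (fun q => (⟨f q, _root_.mfderiv I J f q (constField I p v q)⟩ : TangentBundle J N)) p :=
    fun v => contMDiffAt_mfderiv hf (contMDiffAt_constField v)
  have hB : ContMDiffAt I 𝓘(ℝ, E →L[ℝ] E →L[ℝ] ℝ) ∞ B p :=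
    contMDiffAt_clm_of_apply fun v => contMDiffAt_clm_of_apply fun w =>
      contMDiffAt_metric g (hf p) (hdf v) (hdf w)
  have hβ : ContMDiffAt I 𝓘(ℝ, E →L[ℝ] ℝ) ∞ β p :=
    contMDiffAt_clm_of_apply fun v => contMDiffAt_metric g (hf p) (hW p) (hdf v)
  have hinv : ∀ q ∈ t.baseSet, (B q).IsInvertible := by
    intro q hq
    refine isInvertible_of_pos (B q) fun v hv => ?_
    have h0 : constField I p v q ≠ 0 := by
      intro h0
      have h2 : constField I p v q = constField I p 0 q :=
        h0.trans (map_zero (t.symmL ℝ q)).symm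
      rw [← trivializationAt_constField hq v, h2, trivializationAt_constField hq] at hv
      exact hv rfl
    have h1 : 0 < inducedMetric I g f q (constField I p v q) (constField I p v q) :=
      inducedMetric_pos (himm q) h0
    exact h1
  have hp : p ∈ t.baseSet := FiberBundle.mem_baseSet_trivializationAt' p
  have hz : ContMDiffAt I 𝓘(ℝ, E) ∞ (fun q => (B q).inverse (β q)) p := by
    obtain ⟨e, he⟩ := hinv p hp
    have h := contDiffAt_map_inverse (n := ∞) e
    rw [he] at h
    exact (h.comp_contMDiffAt hB).clm_apply hβ
  refine (contMDiffAt_section p).2 (hz.congr_of_eventuallyEq ?_)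
  filter_upwards [t.open_baseSet.mem_nhds hp] with q hq
  have h : KaehlerSubmanifold.tangential I g f q (W q) =
      constField I p ((B q).inverse (β q)) q := by
    refine tangential_eq (himm q) fun v => ?_
    obtain ⟨a, rfl⟩ := exists_constField_eq hq v
    exact DFunLike.congr_fun ((hinv q hq).self_apply_inverse (β q)) a
  rw [h]
  exact trivializationAt_constField hq _

omit [FiniteDimensional ℝ E] [IsManifold I ∞ M] in
theorem IsSmoothAlong.sub (hf : ContMDiff I J ∞ f) {W W' : FieldAlong J f}
    (hW : IsSmoothAlong I f W) (hW' : IsSmoothAlong I f W') : IsSmoothAlong I f (W - W') := by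
  intro p
  refine contMDiffAt_totalSpace.2 ⟨hf p, ?_⟩
  refine ((contMDiffAt_totalSpace.1 (hW p)).2.sub
    (contMDiffAt_totalSpace.1 (hW' p)).2).congr_of_eventuallyEq ?_
  filter_upwards [eventually_mem_baseSet (J := J) hf.continuous.continuousAt] with q hq
  exact ((trivializationAt F (TangentSpace J) (f p)).linear ℝ hq).map_sub (W q) (W' q)

theorem IsSmoothAlong.isNormalField_normal (hf : ContMDiff I J ∞ f)
    (himm : ∀ p : M, Function.Injective (mfderiv I J f p)) {W : FieldAlong J f}
    (hW : IsSmoothAlong I f W) : IsNormalField I g f (fun q => normal I g f q (W q)) :=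
  ⟨hW.sub hf ((hW.tangential (g := g) hf himm).mfderiv hf),
    fun p v => inner_normal_mfderiv (himm p) (W p) v⟩

end Tangential

/-! ### Gauss and Weingarten formulas, and the four identities. -/

section Gauss

variable {E : Type*} [NormedAddCommGroup E] [NormedSpace ℝ E] [FiniteDimensional ℝ E]
  [CompleteSpace E]
  {H : Type*} [TopologicalSpace H] {I : ModelWithCorners ℝ E H} [I.Boundaryless]
  {M : Type*} [TopologicalSpace M] [T2Space M] [ChartedSpace H M] [IsManifold I ∞ M]
  {F : Type*} [NormedAddCommGroup F] [NormedSpace ℝ F] [FiniteDimensional ℝ F] [CompleteSpace F]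
  {K : Type*} [TopologicalSpace K] {J : ModelWithCorners ℝ F K} [J.Boundaryless]
  {N : Type*} [TopologicalSpace N] [ChartedSpace K N] [IsManifold J ∞ N]
  {g : ContMDiffRiemannianMetric J ∞ F (fun y : N => TangentSpace J y)}
  {φ : EndoField J N} {nablaBar : CovariantDerivative J F (TangentSpace J : N → Type _)}
  {f : M → N} {nabla : CovariantDerivative I E (TangentSpace I : M → Type _)} {p : M}

/-- The Gauss formula: the tangential component of the pulled back Levi-Civita connection is the
Levi-Civita connection of the induced metric. -/
theorem tangential_covAlong_mfderiv (hN : IsLeviCivita g.inner nablaBar)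
    (hM : IsLeviCivita (inducedMetric I g f) nabla) (hf : ContMDiff I J ∞ f)
    (himm : ∀ p : M, Function.Injective (mfderiv I J f p)) {Y : Field I M} (hY : IsSmoothField Y)
    (v : TangentSpace I p) :
    tangential I g f p (covAlong I nablaBar f (fun q => mfderiv I J f q (Y q)) p v) =
      nabla Y p v := by
  -- The difference of two torsion-free metric connections: `D` is symmetric in its first two
  -- arguments and skew in the last two.
  let D : Field I M → Field I M → Field I M → ℝ := fun X Y Z =>
    g.inner (f p) (covAlong I nablaBar f (fun q => mfderiv I J f q (Y q)) p (X p))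
      (mfderiv I J f p (Z p)) - inducedMetric I g f p (nabla Y p (X p)) (Z p)
  have hsymm : ∀ X Y Z, IsSmoothField X → IsSmoothField Y → D X Y Z = D Y X Z := by
    intro X Y Z hX hY
    have h1 := covAlong_mfderiv_sub hN.torsion_free hf (hX.mdifferentiableAt p)
      (hY.mdifferentiableAt p)
    have h2 := nabla.torsion_eq_zero_iff.1 hM.torsion_free (hX.mdifferentiableAt p)
      (hY.mdifferentiableAt p)
    rw [← h2, sub_eq_iff_eq_add, map_sub] at h1
    simp only [D]
    rw [h1, inducedMetric_apply, inducedMetric_apply]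
    simp only [map_add, map_sub, _root_.add_apply, _root_.sub_apply]
    ring
  have hanti : ∀ X Y Z, IsSmoothField Y → IsSmoothField Z → D X Y Z = -D X Z Y := by
    intro X Y Z hY hZ
    have h1 := hN.covAlong_metric hf ((hY.mfderiv hf).isDiffAlongAt p)
      ((hZ.mfderiv hf).isDiffAlongAt p) (X p)
    have h2 := hM.metric Y Z p (hY.mdifferentiableAt p) (hZ.mdifferentiableAt p) (X p)
    have h3 := h1.symm.trans h2
    have h4 : inducedMetric I g f p (Y p) (nabla Z p (X p)) =
        inducedMetric I g f p (nabla Z p (X p)) (Y p) := g.symm _ _ _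
    rw [h4, g.symm (f p) (mfderiv I J f p (Y p))] at h3
    simp only [D]
    linarith
  refine tangential_eq (himm p) fun u => ?_
  obtain ⟨X, hX, rfl⟩ := exists_isSmoothField p v
  obtain ⟨Z, hZ, rfl⟩ := exists_isSmoothField (I := I) p u
  -- Alternating the two symmetries six times returns to `X, Y, Z` after three sign changes, so `D =
  -- -D`.
  have h : D X Y Z = 0 := by
    have h1 := hanti X Y Z hY hZ
    have h2 := hsymm X Z Y hX hZ
    have h3 := hanti Z X Y hX hY
    have h4 := hsymm Z Y X hZ hY
    have h5 := hanti Y Z X hZ hX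
    have h6 := hsymm Y X Z hY hX
    linarith
  exact (sub_eq_zero.1 h).symm

omit [CompleteSpace E] [I.Boundaryless] [T2Space M] [FiniteDimensional ℝ F] [CompleteSpace F]
  [J.Boundaryless] in
theorem covAlong_eq_tangential_add_normal (hf : ContMDiff I J ∞ f)
    (himm : ∀ p : M, Function.Injective (mfderiv I J f p)) {W : FieldAlong J f}
    (hW : IsSmoothAlong I f W) (v : TangentSpace I p) :
    covAlong I nablaBar f W p v =
      covAlong I nablaBar f (fun q => mfderiv I J f q (tangential I g f q (W q))) p v +
        covAlong I nablaBar f (fun q => normal I g f q (W q)) p v := by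
  have h : W = (fun q => mfderiv I J f q (tangential I g f q (W q)) : FieldAlong J f) +
      fun q => normal I g f q (W q) :=
    funext fun q => (mfderiv_tangential_add_normal (g := g) (W q)).symm
  conv_lhs => rw [h]
  rw [covAlong_add nablaBar
    (((hW.tangential (g := g) hf himm).mfderiv hf).isDiffAlongAt p)
    ((hW.isNormalField_normal (g := g) hf himm).1.isDiffAlongAt p), _root_.add_apply]

variable [T2Space N]

/-- The tangential part of `∇̄(φ W) = φ ∇̄W`. -/
theorem IsKaehler.nabla_tangential_endo (hN : IsKaehler g φ nablaBar)
    (hM : IsLeviCivita (inducedMetric I g f) nabla) (hf : ContMDiff I J ∞ f)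
    (himm : ∀ p : M, Function.Injective (mfderiv I J f p)) {W : FieldAlong J f}
    (hW : IsSmoothAlong I f W) (v : TangentSpace I p) :
    nabla (fun q => tangential I g f q (φ (f q) (W q))) p v +
        tangential I g f p (covAlong I nablaBar f
          (fun q => normal I g f q (φ (f q) (W q))) p v) =
      tangential I g f p (φ (f p) (covAlong I nablaBar f W p v)) := by
  have hφW := hW.endo hf hN.almostHermitian.smooth
  rw [← hN.covAlong_endo hf (hW.isDiffAlongAt p),
    covAlong_eq_tangential_add_normal (g := g) hf himm hφW, map_add,
    tangential_covAlong_mfderiv hN.leviCivita hM hf himm (hφW.tangential (g := g) hf himm)]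

omit [CompleteSpace E] [I.Boundaryless] [T2Space M] [J.Boundaryless] in
/-- The normal part of `∇̄(φ W) = φ ∇̄W`. -/
theorem IsKaehler.normal_covAlong_endo (hN : IsKaehler g φ nablaBar) (hf : ContMDiff I J ∞ f)
    (himm : ∀ p : M, Function.Injective (mfderiv I J f p)) {W : FieldAlong J f}
    (hW : IsSmoothAlong I f W) (v : TangentSpace I p) :
    normal I g f p (covAlong I nablaBar f
        (fun q => mfderiv I J f q (tangential I g f q (φ (f q) (W q)))) p v) +
      normal I g f p (covAlong I nablaBar f (fun q => normal I g f q (φ (f q) (W q))) p v) =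
      normal I g f p (φ (f p) (covAlong I nablaBar f W p v)) := by
  have hφW := hW.endo hf hN.almostHermitian.smooth
  rw [← hN.covAlong_endo hf (hW.isDiffAlongAt p),
    covAlong_eq_tangential_add_normal (g := g) hf himm hφW, map_add]

omit [T2Space N] in
theorem covAlong_mfderiv_eq (hN : IsLeviCivita g.inner nablaBar)
    (hM : IsLeviCivita (inducedMetric I g f) nabla) (hf : ContMDiff I J ∞ f)
    (himm : ∀ p : M, Function.Injective (mfderiv I J f p)) (X : Field I M) {Y : Field I M}
    (hY : IsSmoothField Y) :
    covAlong I nablaBar f (fun q => mfderiv I J f q (Y q)) p (X p) =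
      mfderiv I J f p (nabla Y p (X p)) + secondForm I g f nablaBar X Y p := by
  rw [← tangential_covAlong_mfderiv hN hM hf himm hY]
  exact (mfderiv_tangential_add_normal _).symm

-- The Weingarten formula, which is just the splitting of `∇̄_X V`; the sign is the one in the
-- definition of `shape`.
omit [FiniteDimensional ℝ E] [CompleteSpace E] [I.Boundaryless] [T2Space M]
  [FiniteDimensional ℝ F] [CompleteSpace F] [J.Boundaryless] [T2Space N] [IsManifold I ∞ M] in
theorem covAlong_normal_eq (X : Field I M) (V : FieldAlong J f) :
    covAlong I nablaBar f V p (X p) =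
      -mfderiv I J f p (shape I g f nablaBar V X p) + normalCov I g f nablaBar X V p := by
  rw [shape, map_neg, neg_neg]
  exact (mfderiv_tangential_add_normal _).symm

/-- `(∇_X T) Y = A_{NY} X + t h(X, Y)`. -/
theorem IsKaehler.covT_apply (hN : IsKaehler g φ nablaBar)
    (hM : IsLeviCivita (inducedMetric I g f) nabla) (hf : ContMDiff I J ∞ f)
    (himm : ∀ p : M, Function.Injective (mfderiv I J f p)) (X : Field I M) {Y : Field I M}
    (hY : IsSmoothField Y) (p : M) :
    covT I g φ f nabla X Y p =
      shape I g f nablaBar (fun q => opN I g φ f q (Y q)) X p +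
        opt I g φ f p (secondForm I g f nablaBar X Y p) := by
  -- With `W = df Y`, the normal part of `φW` is `NY` and contributes `-A_{NY} X` on the left; by
  -- the Gauss formula the right side is `T(∇_X Y) + t h(X, Y)`.
  have h := hN.nabla_tangential_endo hM hf himm (hY.mfderiv hf) (X p)
  rw [covAlong_mfderiv_eq hN.leviCivita hM hf himm X hY, map_add, map_add,
    ← eq_sub_iff_add_eq] at h
  refine (congrArg (· - opT I g φ f p (nabla Y p (X p))) h).trans ?_
  simp only [shape, opT, opt, opN, ContinuousLinearMap.comp_apply]
  abel

/-- `(∇_X N) Y = -h(X, TY) + n h(X, Y)`. -/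
theorem IsKaehler.covN_apply (hN : IsKaehler g φ nablaBar)
    (hM : IsLeviCivita (inducedMetric I g f) nabla) (hf : ContMDiff I J ∞ f)
    (himm : ∀ p : M, Function.Injective (mfderiv I J f p)) (X : Field I M) {Y : Field I M}
    (hY : IsSmoothField Y) (p : M) :
    covN I g φ f nablaBar nabla X Y p =
      -secondForm I g f nablaBar X (fun q => opT I g φ f q (Y q)) p +
        opn I g φ f p (secondForm I g f nablaBar X Y p) := by
  have h := hN.normal_covAlong_endo hf himm (hY.mfderiv hf) (X p)
  rw [covAlong_mfderiv_eq hN.leviCivita hM hf himm X hY, map_add, map_add,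
    ← eq_sub_iff_add_eq'] at h
  refine (congrArg (· - opN I g φ f p (nabla Y p (X p))) h).trans ?_
  simp only [secondForm, opT, opn, opN, ContinuousLinearMap.comp_apply]
  abel

/-- `(∇_X t) V = A_{nV} X - T (A_V X)`. -/
theorem IsKaehler.covt_apply (hN : IsKaehler g φ nablaBar)
    (hM : IsLeviCivita (inducedMetric I g f) nabla) (hf : ContMDiff I J ∞ f)
    (himm : ∀ p : M, Function.Injective (mfderiv I J f p)) (X : Field I M) {V : FieldAlong J f}
    (hV : IsSmoothAlong I f V) (p : M) :
    covt I g φ f nablaBar nabla X V p =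
      shape I g f nablaBar (fun q => opn I g φ f q (V q)) X p -
        opT I g φ f p (shape I g f nablaBar V X p) := by
  have h := hN.nabla_tangential_endo hM hf himm hV (X p)
  rw [covAlong_normal_eq (g := g) X V, map_add, map_add, map_neg, map_neg,
    ← eq_sub_iff_add_eq] at h
  refine (congrArg (· - opt I g φ f p (normalCov I g f nablaBar X V p)) h).trans ?_
  simp only [shape, opT, opt, opn, ContinuousLinearMap.comp_apply]
  abel

omit [CompleteSpace E] [I.Boundaryless] [T2Space M] [J.Boundaryless] in
/-- `(∇_X n) V = -h(X, tV) - N (A_V X)`. -/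
theorem IsKaehler.covn_apply (hN : IsKaehler g φ nablaBar) (hf : ContMDiff I J ∞ f)
    (himm : ∀ p : M, Function.Injective (mfderiv I J f p)) (X : Field I M) {V : FieldAlong J f}
    (hV : IsSmoothAlong I f V) (p : M) :
    covn I g φ f nablaBar X V p =
      -secondForm I g f nablaBar X (fun q => opt I g φ f q (V q)) p -
        opN I g φ f p (shape I g f nablaBar V X p) := by
  have h := hN.normal_covAlong_endo hf himm hV (X p)
  rw [covAlong_normal_eq (g := g) X V, map_add, map_add, map_neg, map_neg,
    ← eq_sub_iff_add_eq'] at h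
  refine (congrArg (· - opn I g φ f p (normalCov I g f nablaBar X V p)) h).trans ?_
  simp only [secondForm, opN, opt, opn, ContinuousLinearMap.comp_apply]
  abel

omit [CompleteSpace E] [I.Boundaryless] [J.Boundaryless] [T2Space N] in
/-- The shape operators of a totally geodesic submanifold vanish: `g(A_V X, Y) = g(h(X, Y), V)`. -/
theorem IsTotallyGeodesic.shape_eq_zero (h : IsTotallyGeodesic I g f nablaBar)
    (hN : IsLeviCivita g.inner nablaBar) (hf : ContMDiff I J ∞ f)
    (himm : ∀ p : M, Function.Injective (mfderiv I J f p)) {X : Field I M} (hX : IsSmoothField X)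
    {V : FieldAlong J f} (hV : IsNormalField I g f V) (p : M) :
    shape I g f nablaBar V X p = 0 := by
  refine neg_eq_zero.2 (tangential_eq_zero (himm p) fun u => ?_)
  obtain ⟨Y, hY, rfl⟩ := exists_isSmoothField (I := I) p u
  -- The identity `g(V, df Y) = 0` is differentiated along `X`; since `h = 0`, `∇̄_X Y` is
  -- tangential and its pairing with `V` vanishes.
  have h1 := hN.covAlong_metric hf (hV.1.isDiffAlongAt p) ((hY.mfderiv hf).isDiffAlongAt p) (X p)
  have h2 : (fun q => g.inner (f q) (V q) (mfderiv I J f q (Y q))) = fun _ => (0 : ℝ) :=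
    funext fun q => hV.2 q (Y q)
  have h3 : normal I g f p
      (covAlong I nablaBar f (fun q => mfderiv I J f q (Y q)) p (X p)) = 0 :=
    congrFun (h X Y hX hY) p
  rw [h2, mvfderiv_const, ← mfderiv_tangential_add_normal (I := I) (g := g)
    (covAlong I nablaBar f (fun q => mfderiv I J f q (Y q)) p (X p)), h3, add_zero, hV.2,
    add_zero] at h1
  exact h1.symm

end Gauss

end KaehlerSubmanifold

end

open KaehlerSubmanifold in
theorem lemma3p3 {m d : ℕ}
    {M : Type*} [TopologicalSpace M] [T2Space M] [ChartedSpace (EuclideanSpace ℝ (Fin m)) M]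
    [IsManifold (𝓡 m) ∞ M]
    {N : Type*} [TopologicalSpace N] [T2Space N] [ChartedSpace (EuclideanSpace ℝ (Fin d)) N]
    [IsManifold (𝓡 d) ∞ N]
    -- the Kähler manifold `(N, φ, g)` with its Levi-Civita connection
    (g : ContMDiffRiemannianMetric (𝓡 d) ∞ (EuclideanSpace ℝ (Fin d))
      (fun y : N => TangentSpace (𝓡 d) y))
    (φ : EndoField (𝓡 d) N)
    (nablaBar : CovariantDerivative (𝓡 d) (EuclideanSpace ℝ (Fin d))
      (TangentSpace (𝓡 d) : N → Type _))
    (hN : IsKaehler g φ nablaBar)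
    -- the submanifold `M`, given by an injective immersion `f`
    (f : M → N) (hf : ContMDiff (𝓡 m) (𝓡 d) ∞ f) (hinj : Function.Injective f)
    (himm : ∀ p : M, Function.Injective (mfderiv (𝓡 m) (𝓡 d) f p))
    -- the Levi-Civita connection of the induced metric
    (nabla : CovariantDerivative (𝓡 m) (EuclideanSpace ℝ (Fin m))
      (TangentSpace (𝓡 m) : M → Type _))
    (hM : IsLeviCivita (inducedMetric (𝓡 m) g f) nabla) :
    (∀ (X Y : Field (𝓡 m) M) (V : FieldAlong (𝓡 d) f),
      IsSmoothField X → IsSmoothField Y → IsNormalField (𝓡 m) g f V →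
        covT (𝓡 m) g φ f nabla X Y =
          (fun p => shape (𝓡 m) g f nablaBar (fun q => opN (𝓡 m) g φ f q (Y q)) X p +
            opt (𝓡 m) g φ f p (secondForm (𝓡 m) g f nablaBar X Y p)) ∧
        covN (𝓡 m) g φ f nablaBar nabla X Y =
          (fun p => -secondForm (𝓡 m) g f nablaBar X (fun q => opT (𝓡 m) g φ f q (Y q)) p +
            opn (𝓡 m) g φ f p (secondForm (𝓡 m) g f nablaBar X Y p)) ∧
        covt (𝓡 m) g φ f nablaBar nabla X V =
          (fun p => shape (𝓡 m) g f nablaBar (fun q => opn (𝓡 m) g φ f q (V q)) X p -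
            opT (𝓡 m) g φ f p (shape (𝓡 m) g f nablaBar V X p)) ∧
        covn (𝓡 m) g φ f nablaBar X V =
          (fun p => -secondForm (𝓡 m) g f nablaBar X (fun q => opt (𝓡 m) g φ f q (V q)) p -
            opN (𝓡 m) g φ f p (shape (𝓡 m) g f nablaBar V X p))) ∧
    (IsTotallyGeodesic (𝓡 m) g f nablaBar →
      ∀ (X Y : Field (𝓡 m) M) (V : FieldAlong (𝓡 d) f),
        IsSmoothField X → IsSmoothField Y → IsNormalField (𝓡 m) g f V →
          covT (𝓡 m) g φ f nabla X Y = 0 ∧ covN (𝓡 m) g φ f nablaBar nabla X Y = 0 ∧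
          covt (𝓡 m) g φ f nablaBar nabla X V = 0 ∧ covn (𝓡 m) g φ f nablaBar X V = 0) := by
  have formulas : ∀ (X Y : Field (𝓡 m) M) (V : FieldAlong (𝓡 d) f),
      IsSmoothField X → IsSmoothField Y → IsNormalField (𝓡 m) g f V → _ ∧ _ ∧ _ ∧ _ :=
    fun X Y V _ hY hV =>
      ⟨funext (hN.covT_apply hM hf himm X hY), funext (hN.covN_apply hM hf himm X hY),
        funext (hN.covt_apply hM hf himm X hV.1), funext (hN.covn_apply hf himm X hV.1)⟩
  refine ⟨formulas, fun hgeo X Y V hX hY hV => ?_⟩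
  obtain ⟨h1, h2, h3, h4⟩ := formulas X Y V hX hY hV
  have hφ := hN.almostHermitian.smooth
  have hφY := (hY.mfderiv hf).endo hf hφ
  have hφV := hV.1.endo hf hφ
  have hA : ∀ {V : FieldAlong (𝓡 d) f}, IsNormalField (𝓡 m) g f V → ∀ p,
      shape (𝓡 m) g f nablaBar V X p = 0 :=
    fun hV => hgeo.shape_eq_zero hN.leviCivita hf himm hX hV
  have hh : ∀ {Y : Field (𝓡 m) M}, IsSmoothField Y → ∀ p,
      secondForm (𝓡 m) g f nablaBar X Y p = 0 := fun hY => congrFun (hgeo X _ hX hY)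
  -- The vanishing of `h` and `A` is available only on smooth tangent and smooth normal fields, so
  -- the four components of `φY` and `φV` must be shown to be such.
  have hTY : IsSmoothField (fun q => opT (𝓡 m) g φ f q (Y q)) :=
    hφY.tangential (g := g) hf himm
  have hNY : IsNormalField (𝓡 m) g f (fun q => opN (𝓡 m) g φ f q (Y q)) :=
    hφY.isNormalField_normal hf himm
  have htV : IsSmoothField (fun q => opt (𝓡 m) g φ f q (V q)) :=
    hφV.tangential (g := g) hf himm
  have hnV : IsNormalField (𝓡 m) g f (fun q => opn (𝓡 m) g φ f q (V q)) :=
    hφV.isNormalField_normal hf himm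
  refine ⟨h1.trans (funext fun p => ?_), h2.trans (funext fun p => ?_),
    h3.trans (funext fun p => ?_), h4.trans (funext fun p => ?_)⟩
  · rw [hA hNY, hh hY, map_zero, add_zero]
    rfl
  · rw [hh hTY, hh hY, map_zero, add_zero, neg_zero]
    rfl
  · rw [hA hnV, hA hV, map_zero, sub_zero]
    rfl
  · rw [hh htV, hA hV, map_zero, sub_zero, neg_zero]
    rfl
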